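/- Let $\mathcal D_d$ denote the set of positive semidefinite $d\times d$ complex matrices $\rho$ with $\operatorname{tr}\rho\le 1$ (so that it contains all density matrices), let $\langle X,\rho\rangle=\operatorname{tr}(X^\dagger\rho)$, and for a Banach space $\mathcal B$ let $$\rho_{\mathcal B}(\tau)=\sup\Big\{\tfrac{\|x+\tau y\|_{\mathcal B}+\|x-\tau y\|_{\mathcal B}}2-1:\ \|x\|_{\mathcal B}=\|y\|_{\mathcal B}=1\Big\}$$ be its modulus of uniform smoothness. There is a universal constant $c>0$ with the following property. Let $\mathcal B$ be a real Banach space and $s>0$ a number such that $\rho_{\mathcal B}(\tau)\le s\tau^2$ for all $\tau>0$. Let $\Lambda$ be the map from $d\times d$ Hermitian matrices to $\mathcal B$ given by $\Lambda(\rho)=\sum_{i=1}^n\langle X_i,\rho\rangle Y_i$, where each $X_i\ge 0$, $\sum_{i=1}^nX_i\le I$ and each $\|Y_i\|_{\mathcal B}\le 1$, and let $\delta>0$. Then there exist $k\le c\,d^2(d+s)/\delta^2$ and a map $\Lambda'(\rho)=\sum_{i=1}^k\langle X_i',\rho\rangle Y_i'$, where each $X_i'\ge 0$, $\sum_{i=1}^kX_i'\le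 I$ and each $\|Y_i'\|_{\mathcal B}\le 1$, such that $$\max_{\rho\in\mathcal D_d}\|(\Lambda'-\Lambda)(\rho)\|_{\mathcal B}\le\delta .$$ Moreover, $\Lambda'$ can be found efficiently: there is a single randomized algorithm, independent of $\mathcal B$ and of all other data, which, given $n$, $d$, $s$, $\delta$, the matrices $X_i$ and the vectors $Y_i$, always halts within a number of steps that is polynomial in $n$, $d$, $s$ and $1/\delta$, and which with probability at least $2/3$ outputs such $k$, $X_1',\dots,X_k'$, $Y_1',\dots,Y_k'$ (with the same constant $c$). Here a step is an exact arithmetic operation on or comparison of real numbers, an addition, a truncated subtraction or a comparison of natural numbers, a vector operation (addition, scalar multiplication, copying) in $\mathcal B$, or the drawing of an independent uniform random number from $[0,1]$. -/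

import Mathlib

open scoped ComplexOrder

noncomputable section

/-- The modulus of uniform smoothness of a real normed space `B`,
`sup { (‖x + τ y‖ + ‖x - τ y‖) / 2 - 1 : ‖x‖ = ‖y‖ = 1 }`.
The set is bounded above by `|τ|`, so the supremum is a genuine one as soon as `B` is nonzero. -/
def smoothnessModulus (B : Type*) [NormedAddCommGroup B] [NormedSpace ℝ B] (τ : ℝ) : ℝ :=
  sSup {r : ℝ | ∃ x y : B, ‖x‖ = 1 ∧ ‖y‖ = 1 ∧ r = (‖x + τ • y‖ + ‖x - τ • y‖) / 2 - 1}

/-- The real vector space of `d × d` complex Hermitian matrices. -/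
abbrev HermMat (d : ℕ) : Type := selfAdjoint (Matrix (Fin d) (Fin d) ℂ)

/-- The positive semidefinite matrices in the unit ball of the trace norm. -/
def densitySet (d : ℕ) : Set (HermMat d) :=
  {ρ | (ρ : Matrix (Fin d) (Fin d) ℂ).PosSemidef ∧
    (ρ : Matrix (Fin d) (Fin d) ℂ).trace.re ≤ 1}

/-- The Hilbert-Schmidt inner product `⟨X, ρ⟩ = tr (X† ρ)`, which is a real number when both
matrices are Hermitian. -/
def hsInner {d : ℕ} (X : Matrix (Fin d) (Fin d) ℂ) (ρ : HermMat d) : ℝ :=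
  (X.conjTranspose * (ρ : Matrix (Fin d) (Fin d) ℂ)).trace.re

/-- The map `ρ ↦ ∑ i, ⟨X i, ρ⟩ Y i` from Hermitian matrices to `B`. -/
def opMap {B : Type*} [NormedAddCommGroup B] [NormedSpace ℝ B] {d n : ℕ}
    (X : Fin n → Matrix (Fin d) (Fin d) ℂ) (Y : Fin n → B) (ρ : HermMat d) : B :=
  ∑ i, hsInner (X i) ρ • Y i

/-- `X i ≥ 0`, `∑ i, X i ≤ I` and `‖Y i‖ ≤ 1`. -/
structure Admissible {B : Type*} [NormedAddCommGroup B] {d n : ℕ}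
    (X : Fin n → Matrix (Fin d) (Fin d) ℂ) (Y : Fin n → B) : Prop where
  posSemidef : ∀ i, (X i).PosSemidef
  sum_le_one : (1 - ∑ i, X i).PosSemidef
  norm_le_one : ∀ i, ‖Y i‖ ≤ 1

/-- `(X', Y')` with `k` terms is a sparsification of `(X, Y)` with error `δ`, where `k` is at most
`c d² (d + s) / δ²`. -/
structure IsSparsification {B : Type*} [NormedAddCommGroup B] [NormedSpace ℝ B] {d n : ℕ}
    (c s δ : ℝ) (X : Fin n → Matrix (Fin d) (Fin d) ℂ) (Y : Fin n → B)
    (k : ℕ) (X' : Fin k → Matrix (Fin d) (Fin d) ℂ) (Y' : Fin k → B) : Prop where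
  admissible : Admissible X' Y'
  card_le : (k : ℝ) ≤ c * (d : ℝ) ^ 2 * ((d : ℝ) + s) / δ ^ 2
  error_le : ∀ ρ ∈ densitySet d, ‖opMap X' Y' ρ - opMap X Y ρ‖ ≤ δ

/-! A randomized machine with exact real arithmetic.  It has natural-number registers (used for
loops and addresses), multidimensional arrays of real numbers, multidimensional arrays of vectors
of a space `B`, and it can draw independent uniform random numbers from `[0, 1]`.  Programs are
WHILE programs; they mention neither real constants (other than natural numbers) nor the space `B`,
and there is no instruction that evaluates the norm of `B`. -/

namespace RealMachine

/-- Natural-number expressions; `sub` is truncated. -/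
inductive NatExp : Type
  | const (m : ℕ)
  | reg (x : ℕ)
  | add (e f : NatExp)
  | sub (e f : NatExp)

/-- Real expressions; `cell a idx` is the entry of the array number `a` at the index list `idx`. -/
inductive RealExp : Type
  | ofNat (e : NatExp)
  | cell (a : ℕ) (idx : List NatExp)
  | add (e f : RealExp)
  | sub (e f : RealExp)
  | mul (e f : RealExp)
  | div (e f : RealExp)

/-- Vector expressions. -/
inductive VecExp : Type
  | zero
  | cell (a : ℕ) (idx : List NatExp)
  | add (u v : VecExp)
  | smul (e : RealExp) (v : VecExp)

/-- Tests. -/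
inductive Test : Type
  | natLT (e f : NatExp)
  | realLE (e f : RealExp)

/-- Programs. -/
inductive Prog : Type
  | skip
  | setNat (x : ℕ) (e : NatExp)
  | setReal (a : ℕ) (idx : List NatExp) (e : RealExp)
  | setVec (a : ℕ) (idx : List NatExp) (v : VecExp)
  | draw (a : ℕ) (idx : List NatExp)
  | seq (P Q : Prog)
  | ite (b : Test) (P Q : Prog)
  | loop (b : Test) (P : Prog)

/-- The memory; `draws` counts the random numbers used so far. -/
structure State (B : Type*) where
  nat : ℕ → ℕ
  real : ℕ → List ℕ → ℝ
  vec : ℕ → List ℕ → B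
  draws : ℕ

variable {B : Type*} [NormedAddCommGroup B] [NormedSpace ℝ B]

def NatExp.val (σ : State B) : NatExp → ℕ
  | .const m => m
  | .reg x => σ.nat x
  | .add e f => e.val σ + f.val σ
  | .sub e f => e.val σ - f.val σ

/-- Division by zero yields zero. -/
def RealExp.val (σ : State B) : RealExp → ℝ
  | .ofNat e => (e.val σ : ℝ)
  | .cell a idx => σ.real a (idx.map (NatExp.val σ))
  | .add e f => e.val σ + f.val σ
  | .sub e f => e.val σ - f.val σ
  | .mul e f => e.val σ * f.val σ
  | .div e f => e.val σ / f.val σ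

def VecExp.val (σ : State B) : VecExp → B
  | .zero => 0
  | .cell a idx => σ.vec a (idx.map (NatExp.val σ))
  | .add u v => u.val σ + v.val σ
  | .smul e v => e.val σ • v.val σ

def Test.holds (σ : State B) : Test → Prop
  | .natLT e f => e.val σ < f.val σ
  | .realLE e f => e.val σ ≤ f.val σ

def State.putNat (σ : State B) (x m : ℕ) : State B :=
  { σ with nat := Function.update σ.nat x m }

def State.putReal (σ : State B) (a : ℕ) (l : List ℕ) (r : ℝ) : State B :=
  { σ with real := Function.update σ.real a (Function.update (σ.real a) l r) }

def State.putVec (σ : State B) (a : ℕ) (l : List ℕ) (v : B) : State B :=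
  { σ with vec := Function.update σ.vec a (Function.update (σ.vec a) l v) }

/-- `Exec ω P σ σ' t`: with the random numbers `ω 0, ω 1, …`, the program `P` started in the state
`σ` halts in the state `σ'` after `t` steps.  Every elementary command and every evaluation of a
test costs one step (the expressions in a fixed program have bounded size, so this is the number of
elementary operations up to a constant factor). -/
inductive Exec (ω : ℕ → unitInterval) : Prog → State B → State B → ℕ → Prop
  | skip (σ : State B) : Exec ω .skip σ σ 1
  | setNat (σ : State B) (x : ℕ) (e : NatExp) :
      Exec ω (.setNat x e) σ (σ.putNat x (e.val σ)) 1
  | setReal (σ : State B) (a : ℕ) (idx : List NatExp) (e : RealExp) :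
      Exec ω (.setReal a idx e) σ (σ.putReal a (idx.map (NatExp.val σ)) (e.val σ)) 1
  | setVec (σ : State B) (a : ℕ) (idx : List NatExp) (v : VecExp) :
      Exec ω (.setVec a idx v) σ (σ.putVec a (idx.map (NatExp.val σ)) (v.val σ)) 1
  | draw (σ : State B) (a : ℕ) (idx : List NatExp) :
      Exec ω (.draw a idx) σ
        { σ.putReal a (idx.map (NatExp.val σ)) (ω σ.draws : ℝ) with draws := σ.draws + 1 } 1
  | seq {P Q : Prog} {σ σ' σ'' : State B} {t t' : ℕ}
      (h : Exec ω P σ σ' t) (h' : Exec ω Q σ' σ'' t') : Exec ω (.seq P Q) σ σ'' (t + t')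
  | iteTrue {b : Test} {P Q : Prog} {σ σ' : State B} {t : ℕ}
      (hb : b.holds σ) (h : Exec ω P σ σ' t) : Exec ω (.ite b P Q) σ σ' (t + 1)
  | iteFalse {b : Test} {P Q : Prog} {σ σ' : State B} {t : ℕ}
      (hb : ¬ b.holds σ) (h : Exec ω Q σ σ' t) : Exec ω (.ite b P Q) σ σ' (t + 1)
  | loopDone {b : Test} {P : Prog} {σ : State B}
      (hb : ¬ b.holds σ) : Exec ω (.loop b P) σ σ 1
  | loopStep {b : Test} {P : Prog} {σ σ' σ'' : State B} {t t' : ℕ}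
      (hb : b.holds σ) (h : Exec ω P σ σ' t) (h' : Exec ω (.loop b P) σ' σ'' t') :
      Exec ω (.loop b P) σ σ'' (t + t' + 1)

/-- The law of a sequence of independent uniform random numbers in `[0, 1]`. -/
def tapeMeasure : MeasureTheory.Measure (ℕ → unitInterval) :=
  MeasureTheory.Measure.infinitePi fun _ => MeasureTheory.volume

/-- The initial state for the input `n, d, s, δ, X, Y`: the registers `0, 1` hold `n, d`, the real
arrays `0, 1` hold the real and imaginary parts of the entries of the `X i`, the real cells
`2[], 3[]` hold `s, δ`, the vector array `0` holds the `Y i`, and all the rest is zero. -/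
def inputState {n d : ℕ} (s δ : ℝ) (X : Fin n → Matrix (Fin d) (Fin d) ℂ) (Y : Fin n → B) :
    State B where
  nat x := match x with
    | 0 => n
    | 1 => d
    | _ => 0
  real a l := match a, l with
    | 0, [i, p, q] => if h : i < n ∧ p < d ∧ q < d then
        (X ⟨i, h.1⟩ ⟨p, h.2.1⟩ ⟨q, h.2.2⟩).re else 0
    | 1, [i, p, q] => if h : i < n ∧ p < d ∧ q < d then
        (X ⟨i, h.1⟩ ⟨p, h.2.1⟩ ⟨q, h.2.2⟩).im else 0
    | 2, [] => s
    | 3, [] => δ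
    | _, _ => 0
  vec a l := match a, l with
    | 0, [i] => if h : i < n then Y ⟨i, h⟩ else 0
    | _, _ => 0
  draws := 0

/-- The number of terms that a final state describes: register `2`. -/
def State.outCard (σ : State B) : ℕ := σ.nat 2

/-- The matrices that a final state describes: the real arrays `4, 5` hold the real and imaginary
parts of their entries. -/
def State.outMat (σ : State B) (d : ℕ) (j : Fin σ.outCard) : Matrix (Fin d) (Fin d) ℂ :=
  Matrix.of fun p q => ⟨σ.real 4 [j, p, q], σ.real 5 [j, p, q]⟩

/-- The vectors that a final state describes: the vector array `1`. -/
def State.outVec (σ : State B) (j : Fin σ.outCard) : B := σ.vec 1 [(j : ℕ)]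

end RealMachine

end

/-!
The matrices are sampled independently: the index `i` is drawn with probability
`p i = tr (X i) / T`, where `T = ∑ tr (X l) ≤ d`, and a sample contributes the term
`⟨X i, ρ⟩ Y i / (k p i)`, so that the sum of `k` samples has the mean `opMap X Y`.

No covering net of the set of states and no matrix concentration inequality is needed. A map from
Hermitian matrices to `B` has a vector in `B` as its coefficient at each real coordinate of the
matrix, and by the Cauchy-Schwarz inequality its norm on the Hilbert-Schmidt unit ball, which
contains `densitySet d`, is at most the `ℓ²` norm of these coefficients. Uniform smoothness turns
into the inequality `‖x + y‖² + ‖x - y‖² ≤ 2 ‖x‖² + 2 K ‖y‖²` with `K = 3 s + 2`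
(`twoSmooth_of_smoothnessModulus_le`), hence into a type 2 inequality for sums of independent
centred vectors (`TwoSmooth.sum_norm_sum_sq_le`). The second moments of all coordinates of one
sample `⟨X i, ρ⟩ Y i / p i` add up to at most `T² ≤ d²`, because the Hilbert-Schmidt norm of a
positive semidefinite matrix is at most its trace; so the mean square error of `k` samples is at
most `8 K d² / k` (`Admissible.sum_samplingErrorSq_le`). The same estimate in the space `ℝ`, with
all vectors equal to `1`, shows that the sum of the sampled matrices exceeds `∑ X i ≤ 1` by at most
`δ / 4` in the Hilbert-Schmidt norm, and division by `1 + δ / 4` restores admissibility. With `k`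
the integer part of `2000 d² (d + s) / δ²`, Markov's inequality bounds the probability of failure
by `1 / 3`. If this integer part is `0`, then `d = 0` or `δ > 1`, and the empty sum does.

The program `RealMachine.sampler` computes the prefix sums of the traces, finds `k` by counting,
and inverts the distribution function of `p` at each random number. Its behaviour and running time
are established in a Hoare logic for total correctness with time bounds
(`RealMachine.reaches_sampler`). A run is described by the vector `e` of its indices, and the runs
with given `e` lie in a box whose measure is at most `∏ p (e j)`. The existence of a sparsification
follows, because some run succeeds.
-/

open scoped ComplexOrder

noncomputable section

/-! ### Uniform smoothness and random sums -/

/-- A space is `K`-smooth here if `(‖x + y‖² + ‖x - y‖²) / 2 ≤ ‖x‖² + K ‖y‖²` holds throughout;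
an inner product space satisfies this with `K = 1`. -/
def TwoSmooth (B : Type*) [NormedAddCommGroup B] (K : ℝ) : Prop :=
  ∀ x y : B, ‖x + y‖ ^ 2 + ‖x - y‖ ^ 2 ≤ 2 * ‖x‖ ^ 2 + 2 * K * ‖y‖ ^ 2

theorem twoSmooth_real : TwoSmooth ℝ 1 := by
  intro x y
  simp only [Real.norm_eq_abs, sq_abs]
  nlinarith

section Smooth

variable {B : Type*} [NormedAddCommGroup B] [NormedSpace ℝ B]

theorem norm_add_norm_sub_le_of_smoothnessModulus_le {s τ : ℝ} (hτ : 0 < τ)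
    (hs : smoothnessModulus B τ ≤ s * τ ^ 2) {x y : B} (hx : ‖x‖ = 1) (hy : ‖y‖ = 1) :
    (‖x + τ • y‖ + ‖x - τ • y‖) / 2 ≤ 1 + s * τ ^ 2 := by
  have hbdd : BddAbove {r : ℝ | ∃ x y : B, ‖x‖ = 1 ∧ ‖y‖ = 1 ∧
      r = (‖x + τ • y‖ + ‖x - τ • y‖) / 2 - 1} := by
    refine ⟨τ, ?_⟩
    rintro r ⟨x, y, hx, hy, rfl⟩
    have h1 := norm_add_le x (τ • y)
    have h2 := norm_sub_le x (τ • y)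
    rw [norm_smul, Real.norm_of_nonneg hτ.le, hx, hy] at h1 h2
    linarith
  have := (le_csSup hbdd ⟨x, y, hx, hy, rfl⟩).trans hs
  linarith

/-- The passage from the modulus of smoothness, which averages norms, to an inequality between
squares of norms. -/
theorem twoSmooth_of_smoothnessModulus_le {s : ℝ} (hs0 : 0 < s)
    (hs : ∀ τ : ℝ, 0 < τ → smoothnessModulus B τ ≤ s * τ ^ 2) : TwoSmooth B (3 * s + 2) := by
  intro x y
  rcases eq_or_ne x 0 with rfl | hx
  · simp only [zero_add, zero_sub, norm_neg, norm_zero]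
    nlinarith [sq_nonneg ‖y‖]
  rcases eq_or_ne y 0 with rfl | hy
  · simp only [add_zero, sub_zero, norm_zero]
    nlinarith
  have hx' : 0 < ‖x‖ := norm_pos_iff.2 hx
  have hy' : 0 < ‖y‖ := norm_pos_iff.2 hy
  set τ := ‖y‖ / ‖x‖ with hτdef
  have hτ : 0 < τ := div_pos hy' hx'
  have hyτ : ‖y‖ = ‖x‖ * τ := by rw [hτdef]; field_simp
  -- everything is measured in units of `‖x‖`
  set u := ‖x‖⁻¹ • x
  set v := ‖y‖⁻¹ • y
  have hu : ‖u‖ = 1 := norm_smul_inv_norm (𝕜 := ℝ) hx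
  have hv : ‖v‖ = 1 := norm_smul_inv_norm (𝕜 := ℝ) hy
  have hxu : x = ‖x‖ • u := by simp [u, smul_smul, hx'.ne']
  have hyv : y = ‖x‖ • (τ • v) := by
    rw [smul_smul, ← hyτ]; simp [v, smul_smul, hy'.ne']
  have hmean := norm_add_norm_sub_le_of_smoothnessModulus_le hτ (hs τ hτ) hu hv
  have e1 : ‖x + y‖ = ‖x‖ * ‖u + τ • v‖ := by
    conv_lhs => rw [hxu, hyv, ← smul_add, norm_smul, Real.norm_of_nonneg hx'.le]
  have e2 : ‖x - y‖ = ‖x‖ * ‖u - τ • v‖ := by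
    conv_lhs => rw [hxu, hyv, ← smul_sub, norm_smul, Real.norm_of_nonneg hx'.le]
  have hτv : ‖τ • v‖ = τ := by rw [norm_smul, hv, mul_one, Real.norm_of_nonneg hτ.le]
  have h1 : ‖u + τ • v‖ ≤ 1 + τ := (norm_add_le _ _).trans_eq (by rw [hu, hτv])
  have h2 : ‖u - τ • v‖ ≤ 1 + τ := (norm_sub_le _ _).trans_eq (by rw [hu, hτv])
  have h3 : ‖u + τ • v‖ - ‖u - τ • v‖ ≤ 2 * τ := by
    have := norm_sub_norm_le (u + τ • v) (u - τ • v)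
    have h : u + τ • v - (u - τ • v) = (2 : ℝ) • (τ • v) := by module
    rw [h, norm_smul, hτv] at this
    simpa using this
  have h4 : ‖u - τ • v‖ - ‖u + τ • v‖ ≤ 2 * τ := by
    have := norm_sub_norm_le (u - τ • v) (u + τ • v)
    have h : u - τ • v - (u + τ • v) = (-2 : ℝ) • (τ • v) := by module
    rw [h, norm_smul, hτv] at this
    simpa using this
  have ha := norm_nonneg (u + τ • v)
  have hb := norm_nonneg (u - τ • v)
  rw [e1, e2, hyτ]
  generalize ‖u + τ • v‖ = a at *
  generalize ‖u - τ • v‖ = b at *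
  have key : a ^ 2 + b ^ 2 ≤ 2 + 2 * (3 * s + 2) * τ ^ 2 := by
    rcases le_total (s * τ ^ 2) 1 with h | h
    · have hsq : ((a + b) / 2) ^ 2 ≤ (1 + s * τ ^ 2) ^ 2 :=
        pow_le_pow_left₀ (by positivity) hmean 2
      have hdiff : ((a - b) / 2) ^ 2 ≤ τ ^ 2 := sq_le_sq' (by linarith) (by linarith)
      have : 0 ≤ s * τ ^ 2 := by positivity
      nlinarith
    · -- for large `τ` the triangle inequality alone is good enough
      have := pow_le_pow_left₀ ha h1 2
      have := pow_le_pow_left₀ hb h2 2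
      nlinarith [sq_nonneg (τ - 1)]
  nlinarith [mul_le_mul_of_nonneg_left key (sq_nonneg ‖x‖)]

variable {K : ℝ} {ι : Type*} [Fintype ι] {p : ι → ℝ}

theorem norm_weighted_sum_sq_le (hp : ∀ i, 0 ≤ p i) (hp1 : ∑ i, p i = 1) (V : ι → B) :
    ‖∑ i, p i • V i‖ ^ 2 ≤ ∑ i, p i * ‖V i‖ ^ 2 := by
  have h1 : ‖∑ i, p i • V i‖ ≤ ∑ i, p i * ‖V i‖ :=
    (norm_sum_le _ _).trans_eq (by simp [norm_smul, abs_of_nonneg (hp _)])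
  have h2 := (convexOn_pow 2).map_sum_le (t := Finset.univ) (w := p) (p := fun i => ‖V i‖)
    (fun i _ => hp i) hp1 (fun i _ => norm_nonneg _)
  exact (pow_le_pow_left₀ (norm_nonneg _) h1 2).trans (by simpa using h2)

/-- Adding a centred random vector `Z` to `x` increases the mean square norm by at most
`2 K E‖Z‖²`: in the smoothness inequality for `x ± Z`, Jensen's inequality bounds the mean of
`‖x - Z‖²` from below by `‖x‖²`. -/
theorem TwoSmooth.sum_norm_add_sq_le (hK : TwoSmooth B K) (hp : ∀ i, 0 ≤ p i)
    (hp1 : ∑ i, p i = 1) {Z : ι → B} (hZ : ∑ i, p i • Z i = 0) (x : B) :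
    ∑ i, p i * ‖x + Z i‖ ^ 2 ≤ ‖x‖ ^ 2 + 2 * K * ∑ i, p i * ‖Z i‖ ^ 2 := by
  have h1 : ‖x‖ ^ 2 ≤ ∑ i, p i * ‖x - Z i‖ ^ 2 := by
    have := norm_weighted_sum_sq_le hp hp1 (fun i => x - Z i)
    simpa [smul_sub, Finset.sum_sub_distrib, ← Finset.sum_smul, hp1, hZ] using this
  have h2 : ∑ i, p i * ‖x + Z i‖ ^ 2 + ∑ i, p i * ‖x - Z i‖ ^ 2 ≤
      2 * ‖x‖ ^ 2 + 2 * K * ∑ i, p i * ‖Z i‖ ^ 2 := by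
    calc _ = ∑ i, p i * (‖x + Z i‖ ^ 2 + ‖x - Z i‖ ^ 2) := by
          rw [← Finset.sum_add_distrib]; simp [mul_add]
      _ ≤ ∑ i, p i * (2 * ‖x‖ ^ 2 + 2 * K * ‖Z i‖ ^ 2) :=
          Finset.sum_le_sum fun i _ => mul_le_mul_of_nonneg_left (hK x (Z i)) (hp i)
      _ = (∑ i, p i) * (2 * ‖x‖ ^ 2) + 2 * K * ∑ i, p i * ‖Z i‖ ^ 2 := by
          simp only [mul_add, Finset.sum_add_distrib, Finset.sum_mul, Finset.mul_sum]
          congr 1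
          exact Finset.sum_congr rfl fun i _ => by ring
      _ = _ := by rw [hp1, one_mul]
  linarith

/-- The type 2 inequality for sums of `k` independent copies of a centred random vector. -/
theorem TwoSmooth.sum_norm_sum_sq_le (hK : TwoSmooth B K) (hp : ∀ i, 0 ≤ p i)
    (hp1 : ∑ i, p i = 1) {Z : ι → B} (hZ : ∑ i, p i • Z i = 0) (k : ℕ) :
    ∑ e : Fin k → ι, (∏ j, p (e j)) * ‖∑ j, Z (e j)‖ ^ 2 ≤
      k * (2 * K * ∑ i, p i * ‖Z i‖ ^ 2) := by
  induction k with
  | zero => simp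
  | succ k ih =>
    rw [← (Fin.consEquiv fun _ : Fin (k + 1) => ι).sum_comp, Fintype.sum_prod_type_right]
    have hprod : ∑ e : Fin k → ι, ∏ j, p (e j) = 1 := by
      rw [← Fintype.sum_pow, hp1, one_pow]
    calc _ = ∑ e : Fin k → ι, (∏ j, p (e j)) * ∑ i, p i * ‖∑ j, Z (e j) + Z i‖ ^ 2 := by
          refine Finset.sum_congr rfl fun e _ => ?_
          rw [Finset.mul_sum]
          refine Finset.sum_congr rfl fun i _ => ?_
          simp only [Fin.consEquiv_apply, Fin.prod_univ_succ, Fin.sum_univ_succ, Fin.cons_zero,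
            Fin.cons_succ]
          rw [add_comm (Z i)]
          ring
      _ ≤ ∑ e : Fin k → ι, (∏ j, p (e j)) *
            (‖∑ j, Z (e j)‖ ^ 2 + 2 * K * ∑ i, p i * ‖Z i‖ ^ 2) :=
          Finset.sum_le_sum fun e _ => mul_le_mul_of_nonneg_left
            (hK.sum_norm_add_sq_le hp hp1 hZ _) (Finset.prod_nonneg fun j _ => hp _)
      _ ≤ _ := by
          simp only [mul_add, Finset.sum_add_distrib]
          rw [← Finset.sum_mul, hprod]
          push_cast
          linarith

/-- The mean square deviation of an empirical average from the mean. -/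
theorem TwoSmooth.sum_norm_average_sub_sq_le (hK : TwoSmooth B K) (hK0 : 0 ≤ K)
    (hp : ∀ i, 0 ≤ p i) (hp1 : ∑ i, p i = 1) (V : ι → B) {k : ℕ} (hk : 0 < k) :
    ∑ e : Fin k → ι, (∏ j, p (e j)) * ‖(k : ℝ)⁻¹ • ∑ j, V (e j) - ∑ i, p i • V i‖ ^ 2 ≤
      8 * K / k * ∑ i, p i * ‖V i‖ ^ 2 := by
  set v := ∑ i, p i • V i with hv
  have hk' : (0 : ℝ) < k := by exact_mod_cast hk
  have hZ : ∑ i, p i • (V i - v) = 0 := by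
    simp [smul_sub, Finset.sum_sub_distrib, ← Finset.sum_smul, hp1, hv]
  have h := hK.sum_norm_sum_sq_le hp hp1 hZ k
  have hcentre : ∑ i, p i * ‖V i - v‖ ^ 2 ≤ 4 * ∑ i, p i * ‖V i‖ ^ 2 := by
    have h1 : ∀ i, p i * ‖V i - v‖ ^ 2 ≤ p i * (2 * ‖V i‖ ^ 2 + 2 * ‖v‖ ^ 2) := fun i => by
      refine mul_le_mul_of_nonneg_left ?_ (hp i)
      have := pow_le_pow_left₀ (norm_nonneg _) (norm_sub_le (V i) v) 2
      nlinarith [sq_nonneg (‖V i‖ - ‖v‖)]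
    have h2 := norm_weighted_sum_sq_le hp hp1 V
    calc _ ≤ _ := Finset.sum_le_sum fun i _ => h1 i
      _ = 2 * ∑ i, p i * ‖V i‖ ^ 2 + (∑ i, p i) * (2 * ‖v‖ ^ 2) := by
          simp only [mul_add, Finset.sum_add_distrib, Finset.sum_mul, Finset.mul_sum]
          congr 1
          exact Finset.sum_congr rfl fun i _ => by ring
      _ ≤ _ := by rw [hp1]; linarith
  have hterm : ∀ e : Fin k → ι, ‖(k : ℝ)⁻¹ • ∑ j, V (e j) - v‖ ^ 2 =
      ((k : ℝ) ^ 2)⁻¹ * ‖∑ j, (V (e j) - v)‖ ^ 2 := fun e => by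
    have : (k : ℝ)⁻¹ • ∑ j, V (e j) - v = (k : ℝ)⁻¹ • ∑ j, (V (e j) - v) := by
      rw [Finset.sum_sub_distrib, smul_sub]
      simp [← Nat.cast_smul_eq_nsmul ℝ, smul_smul, hk'.ne']
    rw [this, norm_smul, mul_pow]
    simp
  calc _ = ((k : ℝ) ^ 2)⁻¹ * ∑ e : Fin k → ι, (∏ j, p (e j)) * ‖∑ j, (V (e j) - v)‖ ^ 2 := by
        rw [Finset.mul_sum]
        exact Finset.sum_congr rfl fun e _ => by rw [hterm]; ring
    _ ≤ ((k : ℝ) ^ 2)⁻¹ * (k * (2 * K * (4 * ∑ i, p i * ‖V i‖ ^ 2))) := by gcongr; exact h.trans (by gcongr)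
    _ = _ := by field_simp; ring

end Smooth

/-! ### Real coordinates of matrices -/

section Matrices

open Matrix

variable {d : ℕ}

/-- The real and imaginary parts of the entries of a complex matrix, as one real vector. -/
def realCoord (A : Matrix (Fin d) (Fin d) ℂ) : (Fin d × Fin d) ⊕ (Fin d × Fin d) → ℝ :=
  Sum.elim (fun a => (A a.1 a.2).re) (fun a => (A a.1 a.2).im)

theorem re_trace_conjTranspose_mul (A B : Matrix (Fin d) (Fin d) ℂ) :
    (Aᴴ * B).trace.re = ∑ α, realCoord A α * realCoord B α := by
  simp only [Fintype.sum_sum_type, realCoord, Sum.elim_inl, Sum.elim_inr, ← Finset.sum_add_distrib,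
    trace, diag_apply, mul_apply, Complex.re_sum, conjTranspose_apply, Fintype.sum_prod_type]
  rw [Finset.sum_comm]
  simp

theorem hsInner_eq_sum (X : Matrix (Fin d) (Fin d) ℂ) (ρ : HermMat d) :
    hsInner X ρ = ∑ α, realCoord X α * realCoord (ρ : Matrix (Fin d) (Fin d) ℂ) α :=
  re_trace_conjTranspose_mul _ _

theorem sum_realCoord_sq (A : Matrix (Fin d) (Fin d) ℂ) :
    ∑ α, realCoord A α ^ 2 = ∑ p, ∑ q, ‖A p q‖ ^ 2 := by
  simp only [Fintype.sum_sum_type, realCoord, Sum.elim_inl, Sum.elim_inr, ← Finset.sum_add_distrib,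
    Fintype.sum_prod_type, Complex.sq_norm, Complex.normSq_apply, ← sq]

theorem realCoord_sum {ι : Type*} (s : Finset ι) (A : ι → Matrix (Fin d) (Fin d) ℂ)
    (α : (Fin d × Fin d) ⊕ (Fin d × Fin d)) :
    realCoord (∑ i ∈ s, A i) α = ∑ i ∈ s, realCoord (A i) α := by
  rcases α with a | a <;> simp [realCoord, Matrix.sum_apply]

theorem realCoord_smul (r : ℝ) (A : Matrix (Fin d) (Fin d) ℂ)
    (α : (Fin d × Fin d) ⊕ (Fin d × Fin d)) :
    realCoord (r • A) α = r * realCoord A α := by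
  rcases α with a | a <;> simp [realCoord]

theorem realCoord_zero (α : (Fin d × Fin d) ⊕ (Fin d × Fin d)) :
    realCoord (0 : Matrix (Fin d) (Fin d) ℂ) α = 0 := by
  rcases α with a | a <;> simp [realCoord]

theorem realCoord_sub (A B : Matrix (Fin d) (Fin d) ℂ)
    (α : (Fin d × Fin d) ⊕ (Fin d × Fin d)) :
    realCoord (A - B) α = realCoord A α - realCoord B α := by
  rcases α with a | a <;> simp [realCoord]

open scoped MatrixOrder in
theorem exists_eq_conjTranspose_mul_self {A : Matrix (Fin d) (Fin d) ℂ} (hA : A.PosSemidef) :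
    ∃ C : Matrix (Fin d) (Fin d) ℂ, A = Cᴴ * C :=
  CStarAlgebra.nonneg_iff_eq_star_mul_self.mp hA.nonneg

/-- The Hilbert-Schmidt norm of a positive semidefinite matrix is at most its trace. -/
theorem sum_realCoord_sq_le_of_posSemidef {A : Matrix (Fin d) (Fin d) ℂ} (hA : A.PosSemidef) :
    ∑ α, realCoord A α ^ 2 ≤ A.trace.re ^ 2 := by
  obtain ⟨C, rfl⟩ := exists_eq_conjTranspose_mul_self hA
  rw [re_trace_conjTranspose_mul]
  simp only [← sq]
  rw [sum_realCoord_sq, sum_realCoord_sq]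
  have h : ∀ p q, ‖(Cᴴ * C) p q‖ ^ 2 ≤ (∑ r, ‖C r p‖ ^ 2) * ∑ r, ‖C r q‖ ^ 2 := fun p q => by
    have h1 : ‖(Cᴴ * C) p q‖ ≤ ∑ r, ‖C r p‖ * ‖C r q‖ := by
      rw [mul_apply]
      exact (norm_sum_le _ _).trans_eq (by simp)
    exact (pow_le_pow_left₀ (norm_nonneg _) h1 2).trans (Finset.sum_mul_sq_le_sq_mul_sq _ _ _)
  calc _ ≤ ∑ p, ∑ q, (∑ r, ‖C r p‖ ^ 2) * ∑ r, ‖C r q‖ ^ 2 :=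
        Finset.sum_le_sum fun p _ => Finset.sum_le_sum fun q _ => h p q
    _ = _ := by
        rw [← Finset.sum_mul_sum, ← sq, Finset.sum_comm]

/-- A Hermitian matrix is dominated by its Hilbert-Schmidt norm times the identity. -/
theorem posSemidef_smul_one_sub {D : Matrix (Fin d) (Fin d) ℂ} (hD : D.IsHermitian) {ε : ℝ}
    (hε : 0 ≤ ε) (h : ∑ α, realCoord D α ^ 2 ≤ ε ^ 2) :
    (ε • (1 : Matrix (Fin d) (Fin d) ℂ) - D).PosSemidef := by
  have hH : (ε • (1 : Matrix (Fin d) (Fin d) ℂ) - D).IsHermitian := by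
    refine IsHermitian.sub ?_ hD
    simp [IsHermitian, conjTranspose_smul]
  refine PosSemidef.of_dotProduct_mulVec_nonneg hH fun x => ?_
  rw [RCLike.nonneg_iff (K := ℂ)]
  refine ⟨?_, hH.im_star_dotProduct_mulVec_self x⟩
  -- the quadratic form of a matrix at `x` is its inner product with the rank one matrix `x x†`
  have hquad : ∀ A : Matrix (Fin d) (Fin d) ℂ, star x ⬝ᵥ A *ᵥ x =
      (A * vecMulVec x (star x)).trace := fun A => by
    rw [mul_vecMulVec, trace_vecMulVec, dotProduct_comm]
  have hx := sum_realCoord_sq_le_of_posSemidef (posSemidef_vecMulVec_self_star x)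
  have htr : 0 ≤ (vecMulVec x (star x)).trace.re :=
    (Complex.nonneg_iff.1 (posSemidef_vecMulVec_self_star x).trace_nonneg).1
  have hCS := Finset.sum_mul_sq_le_sq_mul_sq Finset.univ (realCoord D)
    (realCoord (vecMulVec x (star x)))
  rw [← re_trace_conjTranspose_mul, hD.eq] at hCS
  have hle : (D * vecMulVec x (star x)).trace.re ≤ ε * (vecMulVec x (star x)).trace.re := by
    refine abs_le_of_sq_le_sq' ?_ (by positivity) |>.2
    calc _ ≤ _ := hCS
      _ ≤ ε ^ 2 * (vecMulVec x (star x)).trace.re ^ 2 := by gcongr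
      _ = _ := by ring
  rw [hquad, sub_mul, trace_sub, smul_mul_assoc, one_mul, trace_smul]
  simpa using hle

end Matrices

/-! ### Sampling the terms of the map -/

section Sampling

variable {B : Type*} [NormedAddCommGroup B] {d n k : ℕ}

/-- The total trace `∑ i, tr (X i)`. -/
def totalTrace (X : Fin n → Matrix (Fin d) (Fin d) ℂ) : ℝ := ∑ i, (X i).trace.re

/-- The probability `tr (X i) / ∑ l, tr (X l)` with which the index `i` is sampled. -/
def samplingProb (X : Fin n → Matrix (Fin d) (Fin d) ℂ) (i : Fin n) : ℝ :=
  (X i).trace.re / totalTrace X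

variable {X : Fin n → Matrix (Fin d) (Fin d) ℂ} {Y : Fin n → B}

theorem trace_re_nonneg {A : Matrix (Fin d) (Fin d) ℂ} (hA : A.PosSemidef) : 0 ≤ A.trace.re :=
  (Complex.nonneg_iff.1 hA.trace_nonneg).1

theorem eq_zero_of_trace_re_eq_zero {A : Matrix (Fin d) (Fin d) ℂ} (hA : A.PosSemidef)
    (h : A.trace.re = 0) : A = 0 :=
  hA.trace_eq_zero_iff.1 (Complex.ext h (Complex.nonneg_iff.1 hA.trace_nonneg).2.symm)

theorem Admissible.totalTrace_le (h : Admissible X Y) : totalTrace X ≤ d := by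
  have := trace_re_nonneg h.sum_le_one
  simp only [Matrix.trace_sub, Matrix.trace_one, Matrix.trace_sum, Complex.sub_re,
    Complex.re_sum, Fintype.card_fin, Complex.natCast_re] at this
  unfold totalTrace
  linarith

theorem Admissible.totalTrace_nonneg (h : Admissible X Y) : 0 ≤ totalTrace X :=
  Finset.sum_nonneg fun i _ => trace_re_nonneg (h.posSemidef i)

theorem Admissible.samplingProb_nonneg (h : Admissible X Y) (i : Fin n) : 0 ≤ samplingProb X i :=
  div_nonneg (trace_re_nonneg (h.posSemidef i)) h.totalTrace_nonneg

theorem sum_samplingProb (hT : 0 < totalTrace X) : ∑ i, samplingProb X i = 1 := by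
  unfold samplingProb
  rw [← Finset.sum_div]
  exact div_self hT.ne'

variable [NormedSpace ℝ B]

/-- The coordinates of the difference between the average of the reweighted samples
`ρ ↦ ⟨X i, ρ⟩ Y i / samplingProb X i`, `i = e 0, …, e (k - 1)`, and the map `opMap X Y`. -/
def samplingError (X : Fin n → Matrix (Fin d) (Fin d) ℂ) (Y : Fin n → B) (e : Fin k → Fin n)
    (α : (Fin d × Fin d) ⊕ (Fin d × Fin d)) : B :=
  (k : ℝ)⁻¹ • ∑ j, ((samplingProb X (e j))⁻¹ * realCoord (X (e j)) α) • Y (e j) -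
    ∑ i, realCoord (X i) α • Y i

/-- The squared Hilbert-Schmidt size of the sampling error. -/
def samplingErrorSq (X : Fin n → Matrix (Fin d) (Fin d) ℂ) (Y : Fin n → B) (e : Fin k → Fin n) :
    ℝ :=
  ∑ α, ‖samplingError X Y e α‖ ^ 2

theorem Admissible.norm_opMap_le_one (h : Admissible X Y) {ρ : HermMat d}
    (hρ : ρ ∈ densitySet d) : ‖opMap X Y ρ‖ ≤ 1 := by
  have hpos : ∀ A : Matrix (Fin d) (Fin d) ℂ, A.PosSemidef → 0 ≤ hsInner A ρ := fun A hA => by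
    obtain ⟨C, hC⟩ := exists_eq_conjTranspose_mul_self hρ.1
    unfold hsInner
    rw [hA.1.eq, hC, ← mul_assoc, Matrix.trace_mul_comm, ← mul_assoc]
    exact trace_re_nonneg (hA.mul_mul_conjTranspose_same C)
  have h1 := hpos _ h.sum_le_one
  have h2 : ‖opMap X Y ρ‖ ≤ ∑ i, hsInner (X i) ρ := by
    refine (norm_sum_le _ _).trans (Finset.sum_le_sum fun i _ => ?_)
    rw [norm_smul, Real.norm_of_nonneg (hpos _ (h.posSemidef i))]
    exact mul_le_of_le_one_right (hpos _ (h.posSemidef i)) (h.norm_le_one i)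
  have h3 : hsInner (1 - ∑ i, X i) ρ =
      (ρ : Matrix (Fin d) (Fin d) ℂ).trace.re - ∑ i, hsInner (X i) ρ := by
    simp [hsInner, sub_mul, Matrix.conjTranspose_sum, Finset.sum_mul, Matrix.trace_sum]
  have := hρ.2
  linarith

/-- Each coordinate of the sampling error is the deviation of an empirical average from its mean,
and the second moments of the coordinates of one sample add up to at most `(totalTrace X)²`. -/
theorem Admissible.sum_samplingErrorSq_le {K : ℝ} (hK : TwoSmooth B K) (hK0 : 0 ≤ K)
    (h : Admissible X Y) (hT : 0 < totalTrace X) (hk : 0 < k) :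
    ∑ e : Fin k → Fin n, (∏ j, samplingProb X (e j)) * samplingErrorSq X Y e ≤
      8 * K * d ^ 2 / k := by
  set p := samplingProb X with hpdef
  have hp := h.samplingProb_nonneg
  have hp1 := sum_samplingProb hT
  have hzero : ∀ i, p i = 0 → X i = 0 := fun i hi =>
    eq_zero_of_trace_re_eq_zero (h.posSemidef i) ((div_eq_zero_iff.1 hi).resolve_right hT.ne')
  let V := fun α i => ((p i)⁻¹ * realCoord (X i) α) • Y i
  have hmean : ∀ α, ∑ i, p i • V α i = ∑ i, realCoord (X i) α • Y i := fun α => by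
    refine Finset.sum_congr rfl fun i _ => ?_
    simp only [V, smul_smul]
    by_cases hi : p i = 0
    · rw [hzero i hi, realCoord_zero]; simp
    · rw [mul_inv_cancel_left₀ hi]
  have hsq : ∑ α, ∑ i, p i * ‖V α i‖ ^ 2 ≤ (d : ℝ) ^ 2 := by
    rw [Finset.sum_comm]
    have hi : ∀ i, ∑ α, p i * ‖V α i‖ ^ 2 ≤ p i * (d : ℝ) ^ 2 := fun i => by
      rw [← Finset.mul_sum]
      refine mul_le_mul_of_nonneg_left ?_ (hp i)
      have h1 : ∀ α, ‖V α i‖ ^ 2 ≤ ((p i)⁻¹) ^ 2 * realCoord (X i) α ^ 2 := fun α => by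
        have : ‖Y i‖ ^ 2 ≤ 1 := pow_le_one₀ (norm_nonneg _) (h.norm_le_one i)
        simp only [V, norm_smul, norm_mul, mul_pow, Real.norm_eq_abs, sq_abs]
        exact mul_le_of_le_one_right (by positivity) this
      calc _ ≤ ∑ α, ((p i)⁻¹) ^ 2 * realCoord (X i) α ^ 2 := Finset.sum_le_sum fun α _ => h1 α
        _ ≤ ((p i)⁻¹) ^ 2 * (X i).trace.re ^ 2 := by
            rw [← Finset.mul_sum]
            exact mul_le_mul_of_nonneg_left (sum_realCoord_sq_le_of_posSemidef (h.posSemidef i))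
              (sq_nonneg _)
        _ ≤ totalTrace X ^ 2 := by
            rw [hpdef, samplingProb, inv_div, ← mul_pow]
            rcases eq_or_ne (X i).trace.re 0 with h0 | h0
            · simp [h0]; positivity
            · rw [div_mul_cancel₀ _ h0]
        _ ≤ (d : ℝ) ^ 2 := pow_le_pow_left₀ hT.le h.totalTrace_le 2
    calc _ ≤ ∑ i, p i * (d : ℝ) ^ 2 := Finset.sum_le_sum fun i _ => hi i
      _ = _ := by rw [← Finset.sum_mul, hp1, one_mul]
  have hα := fun α => hK.sum_norm_average_sub_sq_le hK0 hp hp1 (V α) hk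
  calc _ = ∑ α, ∑ e : Fin k → Fin n, (∏ j, p (e j)) *
          ‖(k : ℝ)⁻¹ • ∑ j, V α (e j) - ∑ i, p i • V α i‖ ^ 2 := by
        rw [Finset.sum_comm]
        refine Finset.sum_congr rfl fun e _ => ?_
        rw [samplingErrorSq, Finset.mul_sum]
        refine Finset.sum_congr rfl fun α _ => ?_
        rw [hmean]
        rfl
    _ ≤ ∑ α, 8 * K / k * ∑ i, p i * ‖V α i‖ ^ 2 := Finset.sum_le_sum fun α _ => hα α
    _ ≤ 8 * K / k * (d : ℝ) ^ 2 := by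
        rw [← Finset.mul_sum]
        gcongr
    _ = _ := by ring

/-- If the sampling error is small, both for `Y` and for the constant vectors `1` (that is, for the
sum of the sampled matrices itself), then the reweighted samples, shrunk by the factor
`(1 + δ / 4)⁻¹` that restores `∑ X' ≤ 1`, are admissible and approximate `opMap X Y`. -/
theorem Admissible.sparsification_of_samplingErrorSq_le (h : Admissible X Y) {δ : ℝ} (hδ : 0 < δ)
    (e : Fin k → Fin n) (hY : samplingErrorSq X Y e ≤ (δ / 2) ^ 2)
    (h1 : samplingErrorSq X (fun _ => (1 : ℝ)) e ≤ (δ / 4) ^ 2)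
    {X' : Fin k → Matrix (Fin d) (Fin d) ℂ} {Y' : Fin k → B}
    (hX' : ∀ j, X' j = ((samplingProb X (e j))⁻¹ / (k * (1 + δ / 4))) • X (e j))
    (hY' : ∀ j, Y' j = Y (e j)) :
    Admissible X' Y' ∧ ∀ ρ ∈ densitySet d, ‖opMap X' Y' ρ - opMap X Y ρ‖ ≤ δ := by
  set η := δ / 4 with hη
  have hη0 : 0 < η := by positivity
  have hw : ∀ j, 0 ≤ (samplingProb X (e j))⁻¹ / (k * (1 + η)) := fun j =>
    div_nonneg (inv_nonneg.2 (h.samplingProb_nonneg _)) (by positivity)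
  have hpsd : ∀ j, (X' j).PosSemidef := fun j => by
    rw [hX' j]
    exact (h.posSemidef _).smul (hw j)
  refine ⟨⟨hpsd, ?_, fun j => by rw [hY' j]; exact h.norm_le_one _⟩, fun ρ hρ => ?_⟩
  · set D := (1 + η) • ∑ j, X' j - ∑ i, X i with hDdef
    have hDH : D.IsHermitian := by
      refine Matrix.IsHermitian.sub ?_ (Matrix.posSemidef_sum _ fun i _ => h.posSemidef i).1
      exact ((Matrix.posSemidef_sum _ fun j _ => hpsd j).smul (by positivity : 0 ≤ 1 + η)).1
    have hD : ∑ α, realCoord D α ^ 2 ≤ η ^ 2 := by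
      refine le_trans (le_of_eq ?_) h1
      refine Finset.sum_congr rfl fun α _ => ?_
      rw [Real.norm_eq_abs, sq_abs, hDdef, realCoord_sub, realCoord_smul, realCoord_sum,
        realCoord_sum, samplingError, smul_eq_mul, Finset.mul_sum, Finset.mul_sum]
      congr 2
      · refine Finset.sum_congr rfl fun j _ => ?_
        rw [hX' j, realCoord_smul, smul_eq_mul, mul_one]
        field_simp
      · simp
    have hfin := ((posSemidef_smul_one_sub hDH hη0.le hD).add h.sum_le_one).smul
      (by positivity : 0 ≤ (1 + η)⁻¹)
    convert hfin using 1
    have : η • (1 : Matrix (Fin d) (Fin d) ℂ) - D + (1 - ∑ i, X i) =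
        (1 + η) • (1 - ∑ j, X' j) := by
      rw [hDdef]; module
    rw [this, inv_smul_smul₀ (by positivity)]
  · have hexp : (1 + η) • opMap X' Y' ρ - opMap X Y ρ =
        ∑ α, realCoord (ρ : Matrix (Fin d) (Fin d) ℂ) α • samplingError X Y e α := by
      simp only [opMap, samplingError, hsInner_eq_sum, smul_sub, Finset.sum_sub_distrib,
        Finset.smul_sum, Finset.sum_smul, smul_smul]
      congr 1
      · rw [Finset.sum_comm]
        refine Finset.sum_congr rfl fun α _ => Finset.sum_congr rfl fun j _ => ?_
        rw [hX' j, hY' j, realCoord_smul]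
        congr 1
        field_simp
      · rw [Finset.sum_comm]
        exact Finset.sum_congr rfl fun α _ => Finset.sum_congr rfl fun i _ => by rw [mul_comm]
    have hρ2 : ∑ α, realCoord (ρ : Matrix (Fin d) (Fin d) ℂ) α ^ 2 ≤ 1 :=
      (sum_realCoord_sq_le_of_posSemidef hρ.1).trans
        (pow_le_one₀ (trace_re_nonneg hρ.1) hρ.2)
    have hclose : ‖(1 + η) • opMap X' Y' ρ - opMap X Y ρ‖ ≤ δ / 2 := by
      rw [hexp]
      have hn : ‖∑ α, realCoord (ρ : Matrix (Fin d) (Fin d) ℂ) α • samplingError X Y e α‖ ≤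
          ∑ α, |realCoord (ρ : Matrix (Fin d) (Fin d) ℂ) α| * ‖samplingError X Y e α‖ :=
        (norm_sum_le _ _).trans_eq (by simp [norm_smul])
      refine hn.trans (abs_le_of_sq_le_sq' ?_ (by positivity)).2
      refine (Finset.sum_mul_sq_le_sq_mul_sq _ _ _).trans ?_
      simp only [sq_abs]
      calc _ ≤ 1 * (δ / 2) ^ 2 := mul_le_mul hρ2 hY (Finset.sum_nonneg fun _ _ => sq_nonneg _) zero_le_one
        _ = _ := one_mul _
    have hΛ := h.norm_opMap_le_one hρ
    have heq : (1 + η) • (opMap X' Y' ρ - opMap X Y ρ) =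
        ((1 + η) • opMap X' Y' ρ - opMap X Y ρ) - η • opMap X Y ρ := by module
    have hle : (1 + η) * ‖opMap X' Y' ρ - opMap X Y ρ‖ ≤ δ / 2 + η := by
      calc _ = ‖(1 + η) • (opMap X' Y' ρ - opMap X Y ρ)‖ := by
            rw [norm_smul, Real.norm_of_nonneg (by positivity)]
        _ ≤ _ := by
            rw [heq]
            refine (norm_sub_le _ _).trans (add_le_add hclose ?_)
            rw [norm_smul, Real.norm_of_nonneg hη0.le]
            exact mul_le_of_le_one_right hη0.le hΛ
    nlinarith [norm_nonneg (opMap X' Y' ρ - opMap X Y ρ)]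

/-- Markov's inequality for the two requirements of
`Admissible.sparsification_of_samplingErrorSq_le` together: the samples that violate one of them
have total probability at most `1 / 3`. -/
theorem Admissible.sum_prob_bad_le {s δ : ℝ} (hs : 0 < s) (hK : TwoSmooth B (3 * s + 2))
    (h : Admissible X Y) (hT : 0 < totalTrace X) (hδ : 0 < δ) (hk : 0 < k)
    (hkR : 1000 * (d : ℝ) ^ 2 * (d + s) / δ ^ 2 ≤ k) (bad : Finset (Fin k → Fin n))
    (hbad : ∀ e ∈ bad, ¬ (samplingErrorSq X Y e ≤ (δ / 2) ^ 2 ∧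
      samplingErrorSq X (fun _ => (1 : ℝ)) e ≤ (δ / 4) ^ 2)) :
    ∑ e ∈ bad, ∏ j, samplingProb X (e j) ≤ 1 / 3 := by
  have h' : Admissible X (fun _ => (1 : ℝ)) := ⟨h.posSemidef, h.sum_le_one, by simp⟩
  have hY := h.sum_samplingErrorSq_le hK (by positivity) hT hk
  have h1 := h'.sum_samplingErrorSq_le twoSmooth_real zero_le_one hT hk
  have hk' : (0 : ℝ) < k := by exact_mod_cast hk
  have hd : (1 : ℝ) ≤ d := by
    have : d ≠ 0 := by
      rintro rfl
      exact absurd h.totalTrace_le (by simpa using hT)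
    exact_mod_cast Nat.one_le_iff_ne_zero.2 this
  rw [div_le_iff₀ (by positivity)] at hkR
  have hterm : ∀ e ∈ bad, (∏ j, samplingProb X (e j)) ≤ (∏ j, samplingProb X (e j)) *
      ((2 / δ) ^ 2 * samplingErrorSq X Y e +
        (4 / δ) ^ 2 * samplingErrorSq X (fun _ => (1 : ℝ)) e) := fun e he => by
    refine le_mul_of_one_le_right (Finset.prod_nonneg fun j _ => h.samplingProb_nonneg _) ?_
    have p1 : 0 ≤ samplingErrorSq X Y e := Finset.sum_nonneg fun _ _ => sq_nonneg _
    have p2 : 0 ≤ samplingErrorSq X (fun _ => (1 : ℝ)) e := Finset.sum_nonneg fun _ _ => sq_nonneg _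
    rcases not_and_or.1 (hbad e he) with hb | hb
    · have : 1 ≤ (2 / δ) ^ 2 * samplingErrorSq X Y e := by
        calc (1 : ℝ) = (2 / δ) ^ 2 * (δ / 2) ^ 2 := by field_simp
          _ ≤ _ := by gcongr; exact (not_le.1 hb).le
      have : 0 ≤ (4 / δ) ^ 2 * samplingErrorSq X (fun _ => (1 : ℝ)) e := by positivity
      linarith
    · have : 1 ≤ (4 / δ) ^ 2 * samplingErrorSq X (fun _ => (1 : ℝ)) e := by
        calc (1 : ℝ) = (4 / δ) ^ 2 * (δ / 4) ^ 2 := by field_simp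
          _ ≤ _ := by gcongr; exact (not_le.1 hb).le
      have : 0 ≤ (2 / δ) ^ 2 * samplingErrorSq X Y e := by positivity
      linarith
  calc _ ≤ ∑ e ∈ bad, (∏ j, samplingProb X (e j)) * ((2 / δ) ^ 2 * samplingErrorSq X Y e +
          (4 / δ) ^ 2 * samplingErrorSq X (fun _ => (1 : ℝ)) e) := Finset.sum_le_sum hterm
    _ ≤ ∑ e, (∏ j, samplingProb X (e j)) * ((2 / δ) ^ 2 * samplingErrorSq X Y e +
          (4 / δ) ^ 2 * samplingErrorSq X (fun _ => (1 : ℝ)) e) := by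
        refine Finset.sum_le_sum_of_subset_of_nonneg (Finset.subset_univ _) fun e _ _ => ?_
        refine mul_nonneg (Finset.prod_nonneg fun j _ => h.samplingProb_nonneg _) ?_
        exact add_nonneg (mul_nonneg (sq_nonneg _) (Finset.sum_nonneg fun _ _ => sq_nonneg _))
          (mul_nonneg (sq_nonneg _) (Finset.sum_nonneg fun _ _ => sq_nonneg _))
    _ = (2 / δ) ^ 2 * ∑ e : Fin k → Fin n, (∏ j, samplingProb X (e j)) * samplingErrorSq X Y e +
          (4 / δ) ^ 2 * ∑ e : Fin k → Fin n, (∏ j, samplingProb X (e j)) *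
            samplingErrorSq X (fun _ => (1 : ℝ)) e := by
        rw [Finset.mul_sum, Finset.mul_sum, ← Finset.sum_add_distrib]
        exact Finset.sum_congr rfl fun e _ => by ring
    _ ≤ (2 / δ) ^ 2 * (8 * (3 * s + 2) * d ^ 2 / k) + (4 / δ) ^ 2 * (8 * 1 * d ^ 2 / k) := by
        gcongr
    _ = (96 * s + 192) * d ^ 2 / (k * δ ^ 2) := by field_simp; ring
    _ ≤ 1 / 3 := by
        rw [div_le_div_iff₀ (by positivity) (by norm_num)]
        have : (d : ℝ) ^ 2 ≤ d ^ 2 * d := le_mul_of_one_le_right (by positivity) hd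
        have : 0 ≤ (d : ℝ) ^ 2 * s := by positivity
        nlinarith

end Sampling

/-! ### Total correctness of programs with time bounds -/

namespace RealMachine

section Logic

variable {B : Type*}

@[simp] theorem State.putNat_nat (σ : State B) (x m y : ℕ) :
    (σ.putNat x m).nat y = if y = x then m else σ.nat y := by
  simp [State.putNat, Function.update_apply]

@[simp] theorem State.putNat_real (σ : State B) (x m : ℕ) : (σ.putNat x m).real = σ.real := rfl

@[simp] theorem State.putNat_vec (σ : State B) (x m : ℕ) : (σ.putNat x m).vec = σ.vec := rfl

@[simp] theorem State.putNat_draws (σ : State B) (x m : ℕ) :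
    (σ.putNat x m).draws = σ.draws := rfl

@[simp] theorem State.putReal_nat (σ : State B) (a : ℕ) (l : List ℕ) (r : ℝ) :
    (σ.putReal a l r).nat = σ.nat := rfl

@[simp] theorem State.putReal_real (σ : State B) (a : ℕ) (l : List ℕ) (r : ℝ) (b : ℕ) :
    (σ.putReal a l r).real b = if b = a then Function.update (σ.real a) l r else σ.real b := by
  simp [State.putReal, Function.update_apply]

@[simp] theorem State.putReal_vec (σ : State B) (a : ℕ) (l : List ℕ) (r : ℝ) :
    (σ.putReal a l r).vec = σ.vec := rfl

@[simp] theorem State.putVec_nat (σ : State B) (a : ℕ) (l : List ℕ) (v : B) :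
    (σ.putVec a l v).nat = σ.nat := rfl

@[simp] theorem State.putVec_vec (σ : State B) (a : ℕ) (l : List ℕ) (v : B) (b : ℕ) :
    (σ.putVec a l v).vec b = if b = a then Function.update (σ.vec a) l v else σ.vec b := by
  simp [State.putVec, Function.update_apply]

variable [NormedAddCommGroup B] [NormedSpace ℝ B]
variable {ω : ℕ → unitInterval} {P Q : Prog} {σ : State B} {N M : ℕ} {A A' : State B → Prop}

/-- With the random numbers `ω`, the program `P` started in `σ` halts after at most `N` steps in a
state that satisfies `A`. -/
def Reaches (ω : ℕ → unitInterval) (P : Prog) (σ : State B) (N : ℕ) (A : State B → Prop) : Prop :=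
  ∃ (σ' : State B) (t : ℕ), Exec ω P σ σ' t ∧ t ≤ N ∧ A σ'

theorem Reaches.mono (h : Reaches ω P σ N A) (hNM : N ≤ M) (hA : ∀ σ', A σ' → A' σ') :
    Reaches ω P σ M A' :=
  let ⟨σ', t, he, ht, ha⟩ := h
  ⟨σ', t, he, ht.trans hNM, hA _ ha⟩

theorem reaches_skip (h : A σ) : Reaches ω .skip σ 1 A :=
  ⟨_, _, .skip σ, le_rfl, h⟩

theorem reaches_setNat {x : ℕ} {e : NatExp} (h : A (σ.putNat x (e.val σ))) :
    Reaches ω (.setNat x e) σ 1 A :=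
  ⟨_, _, .setNat σ x e, le_rfl, h⟩

theorem reaches_setReal {a : ℕ} {idx : List NatExp} {e : RealExp}
    (h : A (σ.putReal a (idx.map (NatExp.val σ)) (e.val σ))) :
    Reaches ω (.setReal a idx e) σ 1 A :=
  ⟨_, _, .setReal σ a idx e, le_rfl, h⟩

theorem reaches_setVec {a : ℕ} {idx : List NatExp} {v : VecExp}
    (h : A (σ.putVec a (idx.map (NatExp.val σ)) (v.val σ))) :
    Reaches ω (.setVec a idx v) σ 1 A :=
  ⟨_, _, .setVec σ a idx v, le_rfl, h⟩

theorem reaches_draw {a : ℕ} {idx : List NatExp}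
    (h : A { σ.putReal a (idx.map (NatExp.val σ)) (ω σ.draws : ℝ) with draws := σ.draws + 1 }) :
    Reaches ω (.draw a idx) σ 1 A :=
  ⟨_, _, .draw σ a idx, le_rfl, h⟩

theorem Reaches.seq (h : Reaches ω P σ N fun σ' => Reaches ω Q σ' M A) :
    Reaches ω (.seq P Q) σ (N + M) A :=
  let ⟨_, _, he, ht, σ', _, he', ht', ha⟩ := h
  ⟨σ', _, .seq he he', add_le_add ht ht', ha⟩

theorem reaches_ite {b : Test} (h : b.holds σ → Reaches ω P σ N A)
    (h' : ¬ b.holds σ → Reaches ω Q σ N A) : Reaches ω (.ite b P Q) σ (N + 1) A := by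
  by_cases hb : b.holds σ
  · obtain ⟨σ', t, he, ht, ha⟩ := h hb
    exact ⟨σ', _, .iteTrue hb he, by omega, ha⟩
  · obtain ⟨σ', t, he, ht, ha⟩ := h' hb
    exact ⟨σ', _, .iteFalse hb he, by omega, ha⟩

/-- A loop whose body is executed exactly `N` times, with the invariant `I i` after `i` rounds. -/
theorem reaches_loop {b : Test} (I : ℕ → State B → Prop)
    (htest : ∀ i ≤ N, ∀ σ, I i σ → (b.holds σ ↔ i < N))
    (hbody : ∀ i < N, ∀ σ, I i σ → Reaches ω P σ M (I (i + 1))) (h : I 0 σ) :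
    Reaches ω (.loop b P) σ (N * (M + 1) + 1) (I N) := by
  suffices H : ∀ r i : ℕ, i + r = N → ∀ σ, I i σ →
      Reaches ω (.loop b P) σ (r * (M + 1) + 1) (I N) from H N 0 (by omega) σ h
  intro r
  induction r with
  | zero =>
    intro i hi σ hσ
    obtain rfl : i = N := by omega
    exact ⟨σ, 1, .loopDone (by simp [htest i le_rfl σ hσ]), by omega, hσ⟩
  | succ r ih =>
    intro i hi σ hσ
    obtain ⟨σ', t, he, ht, ha⟩ := hbody i (by omega) σ hσ
    obtain ⟨σ'', t', he', ht', ha'⟩ := ih (i + 1) (by omega) σ' ha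
    refine ⟨σ'', _, .loopStep ((htest i (by omega) σ hσ).2 (by omega)) he he', ?_, ha'⟩
    rw [Nat.succ_mul]
    omega

end Logic

/-! ### The sampling program -/

/-- `x := x + 1`. -/
def incr (x : ℕ) : Prog := .setNat x (.add (.reg x) (.const 1))

/-- `for x := 0 to m - 1 do P`, where `m` is the content of the register `y`. -/
def forLoop (x y : ℕ) (P : Prog) : Prog :=
  .seq (.setNat x (.const 0)) (.loop (.natLT (.reg x) (.reg y)) (.seq P (incr x)))

/-- The prefix sums `7[i] = ∑ l < i, tr (X l)` for `i ≤ n`. -/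
def prefixSums : Prog :=
  forLoop 3 0 (.seq (.setReal 7 [.add (.reg 3) (.const 1)] (.cell 7 [.reg 3]))
    (forLoop 4 1 (.setReal 7 [.add (.reg 3) (.const 1)]
      (.add (.cell 7 [.add (.reg 3) (.const 1)]) (.cell 0 [.reg 3, .reg 4, .reg 4])))))

/-- The real number `2000 d² (d + s) / δ²`. -/
def sizeExp : RealExp :=
  .div (.mul (.mul (.ofNat (.const 2000)) (.mul (.ofNat (.reg 1)) (.ofNat (.reg 1))))
    (.add (.ofNat (.reg 1)) (.cell 2 []))) (.mul (.cell 3 []) (.cell 3 []))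

/-- The register `2` receives the integer part of `sizeExp`, by counting. -/
def computeSize : Prog :=
  .loop (.realLE (.ofNat (.add (.reg 2) (.const 1))) sizeExp) (incr 2)

/-- One random index, in the register `7`: the last `i < n` with `7[i] ≤ u 7[n]`, where `u` is a
fresh random number. -/
def drawIndex : Prog :=
  .seq (.draw 8 []) (.seq (.setNat 7 (.const 0)) (forLoop 3 0
    (.ite (.realLE (.cell 7 [.reg 3]) (.mul (.cell 8 []) (.cell 7 [.reg 0])))
      (.setNat 7 (.reg 3)) .skip)))

/-- The weight of the term with index `m`, the content of the register `7`:
`7[n] / (7[m + 1] - 7[m]) / (k (1 + δ / 4))`. For a term of trace zero, division by zero gives the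
weight `0`, which is harmless because such a term vanishes. -/
def weightExp : RealExp :=
  .div (.div (.cell 7 [.reg 0])
      (.sub (.cell 7 [.add (.reg 7) (.const 1)]) (.cell 7 [.reg 7])))
    (.mul (.ofNat (.reg 2)) (.add (.ofNat (.const 1)) (.div (.cell 3 []) (.ofNat (.const 4)))))

/-- The output of one reweighted term. -/
def writeTerm : Prog :=
  .seq (.setVec 1 [.reg 6] (.cell 0 [.reg 7])) (forLoop 4 1 (forLoop 5 1
    (.seq (.setReal 4 [.reg 6, .reg 4, .reg 5] (.mul weightExp (.cell 0 [.reg 7, .reg 4, .reg 5])))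
      (.setReal 5 [.reg 6, .reg 4, .reg 5] (.mul weightExp (.cell 1 [.reg 7, .reg 4, .reg 5]))))))

/-- The whole algorithm. -/
def sampler : Prog :=
  .seq prefixSums (.seq computeSize (forLoop 6 2 (.seq drawIndex writeTerm)))

section Memory

variable {B : Type*} {σ : State B}

/-- The input data, which the program never overwrites. -/
structure HasInput (n d : ℕ) (s δ : ℝ) (re im : List ℕ → ℝ) (y : List ℕ → B) (σ : State B) :
    Prop where
  nat_n : σ.nat 0 = n
  nat_d : σ.nat 1 = d
  real_re : σ.real 0 = re
  real_im : σ.real 1 = im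
  real_s : σ.real 2 [] = s
  real_δ : σ.real 3 [] = δ
  vec_y : σ.vec 0 = y

variable {n d : ℕ} {s δ : ℝ} {re im : List ℕ → ℝ} {y : List ℕ → B}

theorem HasInput.putNat (h : HasInput n d s δ re im y σ) {x : ℕ} (m : ℕ) (hx : 2 ≤ x) :
    HasInput n d s δ re im y (σ.putNat x m) where
  nat_n := by rw [State.putNat_nat, if_neg (by omega), h.nat_n]
  nat_d := by rw [State.putNat_nat, if_neg (by omega), h.nat_d]
  real_re := h.real_re
  real_im := h.real_im
  real_s := h.real_s
  real_δ := h.real_δ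
  vec_y := h.vec_y

theorem HasInput.putReal (h : HasInput n d s δ re im y σ) {a : ℕ} (l : List ℕ) (r : ℝ)
    (ha : 4 ≤ a) : HasInput n d s δ re im y (σ.putReal a l r) where
  nat_n := h.nat_n
  nat_d := h.nat_d
  real_re := by rw [State.putReal_real, if_neg (by omega), h.real_re]
  real_im := by rw [State.putReal_real, if_neg (by omega), h.real_im]
  real_s := by rw [State.putReal_real, if_neg (by omega), h.real_s]
  real_δ := by rw [State.putReal_real, if_neg (by omega), h.real_δ]
  vec_y := h.vec_y

/-- `∑ l < i, ∑ p < d, re [l, p, p]`. -/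
def tracePrefix (d : ℕ) (re : List ℕ → ℝ) (i : ℕ) : ℝ :=
  ∑ l ∈ Finset.range i, ∑ p ∈ Finset.range d, re [l, p, p]

/-- The data that are fixed during the sampling phase: the input, the number `k` of samples and
the array `S` of prefix sums. -/
structure Ready (n d : ℕ) (s δ : ℝ) (re im : List ℕ → ℝ) (y : List ℕ → B) (k : ℕ)
    (S : List ℕ → ℝ) (σ : State B) : Prop extends HasInput n d s δ re im y σ where
  nat_k : σ.nat 2 = k
  real_S : σ.real 7 = S

variable {k : ℕ} {S : List ℕ → ℝ}

theorem Ready.putNat (h : Ready n d s δ re im y k S σ) {x : ℕ} (m : ℕ) (hx : 3 ≤ x) :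
    Ready n d s δ re im y k S (σ.putNat x m) where
  toHasInput := h.toHasInput.putNat m (by omega)
  nat_k := by rw [State.putNat_nat, if_neg (by omega), h.nat_k]
  real_S := h.real_S

theorem Ready.putReal (h : Ready n d s δ re im y k S σ) {a : ℕ} (l : List ℕ) (r : ℝ)
    (ha : 4 ≤ a) (ha7 : 7 ≠ a) : Ready n d s δ re im y k S (σ.putReal a l r) where
  toHasInput := h.toHasInput.putReal l r ha
  nat_k := h.nat_k
  real_S := by simp [h.real_S, ha7]

theorem Ready.putVec (h : Ready n d s δ re im y k S σ) (l : List ℕ) (v : B) :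
    Ready n d s δ re im y k S (σ.putVec 1 l v) :=
  { h with vec_y := by simpa using h.vec_y }

/-- The index `m < n` is compatible with the random number `u`: `u T` lies weakly between the
prefix sums number `m` and `m + 1`, where `T` is the prefix sum number `n`. -/
def Selects (n : ℕ) (S : List ℕ → ℝ) (u : ℝ) (m : ℕ) : Prop :=
  m < n ∧ S [m] ≤ u * S [n] ∧ u * S [n] ≤ S [m + 1]

/-- The weight that the program gives to the term with index `m`. -/
def weight (n : ℕ) (δ : ℝ) (k : ℕ) (S : List ℕ → ℝ) (m : ℕ) : ℝ :=
  S [n] / (S [m + 1] - S [m]) / (k * (1 + δ / 4))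

theorem Ready.weightExp_val (h : Ready n d s δ re im y k S σ) {m : ℕ} (hm : σ.nat 7 = m) :
    weightExp.val σ = weight n δ k S m := by
  simp [weightExp, weight, RealExp.val, NatExp.val, h.real_S, h.nat_n, h.nat_k, h.real_δ, hm]

/-- The output term number `j` is the input term number `m`, with its weight. -/
structure TermWritten (n d : ℕ) (δ : ℝ) (re im : List ℕ → ℝ) (y : List ℕ → B) (k : ℕ)
    (S : List ℕ → ℝ) (j m : ℕ) (σ : State B) : Prop where
  re_out : ∀ p < d, ∀ q < d, σ.real 4 [j, p, q] = weight n δ k S m * re [m, p, q]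
  im_out : ∀ p < d, ∀ q < d, σ.real 5 [j, p, q] = weight n δ k S m * im [m, p, q]
  vec_out : σ.vec 1 [j] = y [m]

/-- What does not change while the output term number `j` is being written, after `σ₀`. -/
structure Writing (n d : ℕ) (s δ : ℝ) (re im : List ℕ → ℝ) (y : List ℕ → B) (k : ℕ)
    (S : List ℕ → ℝ) (j m : ℕ) (σ₀ σ : State B) : Prop extends Ready n d s δ re im y k S σ where
  nat_j : σ.nat 6 = j
  nat_m : σ.nat 7 = m
  draws_eq : σ.draws = σ₀.draws
  vec_out : σ.vec 1 [j] = y [m]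
  re_frame : ∀ l ≠ j, ∀ p q, σ.real 4 [l, p, q] = σ₀.real 4 [l, p, q]
  im_frame : ∀ l ≠ j, ∀ p q, σ.real 5 [l, p, q] = σ₀.real 5 [l, p, q]
  vec_frame : ∀ l ≠ j, σ.vec 1 [l] = σ₀.vec 1 [l]

variable {j m : ℕ} {σ₀ : State B}

theorem Writing.putNat (h : Writing n d s δ re im y k S j m σ₀ σ) {x : ℕ} (i : ℕ) (hx : 3 ≤ x)
    (hx' : x < 6) : Writing n d s δ re im y k S j m σ₀ (σ.putNat x i) :=
  { h with
    toReady := h.toReady.putNat i hx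
    nat_j := by rw [State.putNat_nat, if_neg (by omega), h.nat_j]
    nat_m := by rw [State.putNat_nat, if_neg (by omega), h.nat_m] }

theorem Writing.putReal (h : Writing n d s δ re im y k S j m σ₀ σ) {a : ℕ} (p q : ℕ) (r : ℝ)
    (ha : 4 ≤ a) (ha' : a < 7) : Writing n d s δ re im y k S j m σ₀ (σ.putReal a [j, p, q] r) :=
  { h with
    toReady := h.toReady.putReal _ r ha (by omega)
    re_frame := fun l hl p q => by
      rw [← h.re_frame l hl p q, State.putReal_real]
      split_ifs with h4
      · simp [h4, hl]
      · rfl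
    im_frame := fun l hl p q => by
      rw [← h.im_frame l hl p q, State.putReal_real]
      split_ifs with h4
      · simp [h4, hl]
      · rfl }

end Memory

section Correctness

variable {B : Type*} [NormedAddCommGroup B] [NormedSpace ℝ B]
variable {ω : ℕ → unitInterval} {P : Prog} {σ : State B} {N M : ℕ}
variable {n d k j m : ℕ} {s δ : ℝ} {re im S : List ℕ → ℝ} {y : List ℕ → B}

theorem reaches_forLoop {x y : ℕ} (hxy : x ≠ y) (I : ℕ → State B → Prop)
    (hbody : ∀ i < N, ∀ σ : State B, σ.nat x = i → σ.nat y = N → I i σ →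
      Reaches ω P σ M fun σ' => σ'.nat x = i ∧ σ'.nat y = N ∧ I (i + 1) (σ'.putNat x (i + 1)))
    (hN : σ.nat y = N) (h : I 0 (σ.putNat x 0)) :
    Reaches ω (forLoop x y P) σ (N * (M + 2) + 2) (I N) := by
  have key : Reaches ω (forLoop x y P) σ (1 + (N * (M + 1 + 1) + 1))
      fun σ' => (σ'.nat x = N ∧ σ'.nat y = N) ∧ I N σ' := by
    refine Reaches.seq (reaches_setNat ?_)
    refine reaches_loop (fun i σ' => (σ'.nat x = i ∧ σ'.nat y = N) ∧ I i σ') ?_ ?_ ?_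
    · rintro i - σ' ⟨⟨h1, h2⟩, -⟩
      simp [Test.holds, NatExp.val, h1, h2]
    · rintro i hi σ' ⟨⟨h1, h2⟩, h3⟩
      refine Reaches.seq ((hbody i hi σ' h1 h2 h3).mono le_rfl ?_)
      rintro σ'' ⟨h4, h5, h6⟩
      refine reaches_setNat ?_
      simp only [NatExp.val, h4, State.putNat_nat, if_true]
      exact ⟨⟨trivial, by rw [if_neg hxy.symm, h5]⟩, h6⟩
    · simp only [NatExp.val, State.putNat_nat, if_true]
      exact ⟨⟨trivial, by rw [if_neg hxy.symm, hN]⟩, h⟩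
  exact key.mono (by ring_nf; omega) fun σ' h => h.2

theorem reaches_prefixSums (hσ : HasInput n d s δ re im y σ) (h0 : σ.real 7 [0] = 0)
    (h2 : σ.nat 2 = 0) (hdr : σ.draws = 0) :
    Reaches ω prefixSums σ (n * (d * 3 + 5) + 2) fun σ' => HasInput n d s δ re im y σ' ∧
      (∀ i ≤ n, σ'.real 7 [i] = tracePrefix d re i) ∧ σ'.nat 2 = 0 ∧ σ'.draws = 0 := by
  refine (reaches_forLoop (M := 1 + (d * (1 + 2) + 2)) (N := n) (by decide)
    (fun i σ' => HasInput n d s δ re im y σ' ∧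
      (∀ l ≤ i, σ'.real 7 [l] = tracePrefix d re l) ∧ σ'.nat 2 = 0 ∧ σ'.draws = 0)
    ?_ hσ.nat_n ?_).mono (by ring_nf; omega) fun σ' h => h
  · rintro i hi σ hi3 - ⟨hσ, hS, h2, hdr⟩
    refine Reaches.seq (reaches_setReal ?_)
    refine (reaches_forLoop (M := 1) (N := d) (by decide)
      (fun p σ' => HasInput n d s δ re im y σ' ∧ (∀ l ≤ i, σ'.real 7 [l] = tracePrefix d re l) ∧
        σ'.nat 2 = 0 ∧ σ'.draws = 0 ∧ σ'.nat 3 = i ∧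
        σ'.real 7 [i + 1] = tracePrefix d re i + ∑ q ∈ Finset.range p, re [i, q, q])
      ?_ ?_ ?_).mono le_rfl ?_
    · rintro p hp σ hp4 - ⟨hσ, hS, h2, hdr, h3, h7⟩
      refine reaches_setReal ⟨by simpa using hp4, by simpa using hσ.nat_d,
        (hσ.putReal _ _ (by norm_num)).putNat _ (by norm_num), fun l hl => ?_, by simpa using h2,
        hdr, by simpa using h3, ?_⟩
      · have : l ≠ i + 1 := by omega
        simp [NatExp.val, h3, this, hS l hl]
      · simp [NatExp.val, RealExp.val, h3, hp4, h7, hσ.real_re, Finset.sum_range_succ, add_assoc]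
    · exact hσ.nat_d
    · refine ⟨(hσ.putReal _ _ (by norm_num)).putNat _ (by norm_num), fun l hl => ?_,
        by simpa using h2, hdr, by simpa using hi3, ?_⟩
      · have : l ≠ i + 1 := by omega
        simp [NatExp.val, hi3, this, hS l hl]
      · simp [NatExp.val, RealExp.val, hi3, hS i le_rfl]
    · rintro σ ⟨hσ, hS, h2, hdr, h3, h7⟩
      refine ⟨h3, hσ.nat_n, hσ.putNat _ (by norm_num), fun l hl => ?_, by simpa using h2, hdr⟩
      rcases hl.lt_or_eq with hl | rfl
      · exact hS l (by omega)
      · simpa [tracePrefix, Finset.sum_range_succ _ i] using h7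
  · refine ⟨hσ.putNat _ (by norm_num), fun l hl => ?_, by simpa using h2, hdr⟩
    obtain rfl : l = 0 := by omega
    simpa [tracePrefix] using h0

theorem reaches_computeSize (hσ : HasInput n d s δ re im y σ) (h2 : σ.nat 2 = 0)
    (hdr : σ.draws = 0) (hR : 0 ≤ 2000 * (d : ℝ) ^ 2 * (d + s) / δ ^ 2) :
    Reaches ω computeSize σ (⌊2000 * (d : ℝ) ^ 2 * (d + s) / δ ^ 2⌋₊ * 2 + 1) fun σ' =>
      Ready n d s δ re im y ⌊2000 * (d : ℝ) ^ 2 * (d + s) / δ ^ 2⌋₊ (σ.real 7) σ' ∧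
        σ'.draws = 0 := by
  refine (reaches_loop (M := 1) (fun i σ' => Ready n d s δ re im y i (σ.real 7) σ' ∧
    σ'.draws = 0) ?_ ?_ ⟨⟨hσ, h2, rfl⟩, hdr⟩).mono le_rfl fun σ' h => h
  · rintro i - σ' ⟨h, -⟩
    rw [← Nat.succ_le_iff, Nat.le_floor_iff hR]
    simp [Test.holds, RealExp.val, NatExp.val, sizeExp, h.nat_k, h.nat_d, h.real_s, h.real_δ, ← sq]
  · rintro i - σ' ⟨h, hdr⟩
    refine reaches_setNat ⟨⟨h.toHasInput.putNat _ le_rfl, ?_, h.real_S⟩, hdr⟩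
    simp [NatExp.val, h.nat_k]

theorem reaches_drawIndex (hσ : Ready n d s δ re im y k S σ) (hS0 : S [0] = 0)
    (hSn : 0 ≤ S [n]) :
    Reaches ω drawIndex σ (n * 4 + 4) fun σ' => Ready n d s δ re im y k S σ' ∧
      σ'.nat 6 = σ.nat 6 ∧ σ'.draws = σ.draws + 1 ∧ σ'.real 4 = σ.real 4 ∧
      σ'.real 5 = σ.real 5 ∧ σ'.vec 1 = σ.vec 1 ∧
      (0 < n → Selects n S (ω σ.draws) (σ'.nat 7)) := by
  set u : ℝ := (ω σ.draws : ℝ) with hu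
  have hu0 : 0 ≤ u := unitInterval.nonneg _
  have hu1 : u ≤ 1 := unitInterval.le_one _
  refine Reaches.mono (N := 1 + (1 + (n * (2 + 2) + 2))) (A := fun σ' =>
      (Ready n d s δ re im y k S σ' ∧ σ'.nat 6 = σ.nat 6 ∧ σ'.draws = σ.draws + 1 ∧
        σ'.real 4 = σ.real 4 ∧ σ'.real 5 = σ.real 5 ∧ σ'.vec 1 = σ.vec 1 ∧ σ'.real 8 [] = u) ∧
      (0 < n → σ'.nat 7 < n ∧ S [σ'.nat 7] ≤ u * S [n] ∧
        (σ'.nat 7 + 1 < n → u * S [n] ≤ S [σ'.nat 7 + 1]))) ?_ (by omega) ?_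
  · refine Reaches.seq (reaches_draw (Reaches.seq (reaches_setNat ?_)))
    refine reaches_forLoop (by decide) (fun i σ' =>
      (Ready n d s δ re im y k S σ' ∧ σ'.nat 6 = σ.nat 6 ∧ σ'.draws = σ.draws + 1 ∧
        σ'.real 4 = σ.real 4 ∧ σ'.real 5 = σ.real 5 ∧ σ'.vec 1 = σ.vec 1 ∧ σ'.real 8 [] = u) ∧
      (0 < i → σ'.nat 7 < i ∧ S [σ'.nat 7] ≤ u * S [n] ∧
        (σ'.nat 7 + 1 < i → u * S [n] ≤ S [σ'.nat 7 + 1]))) ?_ ?_ ?_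
    · rintro i hi σ' h3 h0 ⟨⟨hr, h6, hdr, h4, h5, h1, h8⟩, hm⟩
      refine reaches_ite (fun hb => reaches_setNat ?_) fun hb => reaches_skip ?_
      · have hb' : S [i] ≤ u * S [n] := by
          simpa [Test.holds, RealExp.val, NatExp.val, h3, h0, h8, hr.real_S] using hb
        refine ⟨by simpa using h3, by simpa using h0,
          ⟨(hr.putNat _ (by norm_num)).putNat _ (by norm_num), by simpa using h6, hdr, h4, h5, h1,
            h8⟩, fun _ => ?_⟩
        simp [NatExp.val, h3, hb']
      · have hb' : u * S [n] < S [i] := by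
          simpa [Test.holds, RealExp.val, NatExp.val, h3, h0, h8, hr.real_S] using hb
        refine ⟨h3, h0, ⟨hr.putNat _ (by norm_num), by simpa using h6, hdr, h4, h5, h1, h8⟩,
          fun _ => ?_⟩
        have hi0 : 0 < i := by
          rcases Nat.eq_zero_or_pos i with rfl | h
          · rw [hS0] at hb'
            exact absurd hb' (not_lt.2 (by positivity))
          · exact h
        obtain ⟨hlt, hle, hnext⟩ := hm hi0
        simp only [State.putNat_nat, Nat.reduceEqDiff, if_false]
        refine ⟨by omega, hle, fun hlt' => ?_⟩
        rcases (by omega : σ'.nat 7 + 1 ≤ i).lt_or_eq with h | h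
        · exact hnext h
        · rw [h]; exact hb'.le
    · simpa using hσ.nat_n
    · refine ⟨⟨⟨?_, ?_, ?_⟩, ?_, ?_, ?_, ?_, ?_, ?_⟩, fun h => absurd h (lt_irrefl 0)⟩
      · exact ((hσ.toHasInput.putReal [] u (by norm_num : 4 ≤ 8)).putNat (x := 7) 0
          (by norm_num)).putNat (x := 3) 0 (by norm_num) |> fun h => ⟨h.1, h.2, h.3, h.4, h.5, h.6,
          h.7⟩
      all_goals simp [hσ.nat_k, hσ.real_S, hu]
  · rintro σ' ⟨⟨hr, h6, hdr, h4, h5, h1, -⟩, hm⟩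
    refine ⟨hr, h6, hdr, h4, h5, h1, fun hn => ?_⟩
    obtain ⟨hlt, hle, hnext⟩ := hm hn
    refine ⟨hlt, hle, ?_⟩
    rcases (by omega : σ'.nat 7 + 1 ≤ n).lt_or_eq with h | h
    · exact hnext h
    · rw [h]; exact mul_le_of_le_one_left hSn hu1

theorem reaches_writeTerm (hσ : Ready n d s δ re im y k S σ) (hj : σ.nat 6 = j)
    (hm : σ.nat 7 = m) :
    Reaches ω writeTerm σ (d * (d * 4 + 4) + 3) fun σ' =>
      Writing n d s δ re im y k S j m σ σ' ∧ TermWritten n d δ re im y k S j m σ' := by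
  refine Reaches.mono (N := 1 + (d * (d * (1 + 1 + 2) + 2 + 2) + 2)) (A := fun σ' =>
    Writing n d s δ re im y k S j m σ σ' ∧
      ∀ p < d, ∀ q < d, σ'.real 4 [j, p, q] = weight n δ k S m * re [m, p, q] ∧
        σ'.real 5 [j, p, q] = weight n δ k S m * im [m, p, q]) ?_ (by ring_nf; omega)
    fun σ' h => ⟨h.1, fun p hp q hq => (h.2 p hp q hq).1, fun p hp q hq => (h.2 p hp q hq).2,
      h.1.vec_out⟩
  refine Reaches.seq (reaches_setVec ?_)
  refine reaches_forLoop (by decide) (fun p' σ' => Writing n d s δ re im y k S j m σ σ' ∧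
      ∀ p < p', ∀ q < d, σ'.real 4 [j, p, q] = weight n δ k S m * re [m, p, q] ∧
        σ'.real 5 [j, p, q] = weight n δ k S m * im [m, p, q]) ?_ (by simpa using hσ.nat_d) ?_
  · rintro p' hp' σ' h4 - ⟨hw, hout⟩
    refine (reaches_forLoop (N := d) (by decide) (fun q' σ' => Writing n d s δ re im y k S j m σ σ' ∧
      σ'.nat 4 = p' ∧ ∀ p q, (p < p' ∧ q < d ∨ p = p' ∧ q < q') →
        σ'.real 4 [j, p, q] = weight n δ k S m * re [m, p, q] ∧
        σ'.real 5 [j, p, q] = weight n δ k S m * im [m, p, q]) ?_ hw.nat_d ?_).mono le_rfl ?_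
    · rintro q' hq' σ' h5 - ⟨hw, h4, hout⟩
      refine Reaches.seq (reaches_setReal (reaches_setReal ?_))
      simp only [List.map_cons, List.map_nil, NatExp.val, State.putReal_nat, hw.nat_j, h4, h5]
      have hw1 := hw.putReal p' q' ((weightExp.mul (.cell 0 [.reg 7, .reg 4, .reg 5])).val σ')
        (by norm_num : 4 ≤ 4) (by norm_num)
      have hw2 := hw1.putReal p' q' ((weightExp.mul (.cell 1 [.reg 7, .reg 4, .reg 5])).val
        (σ'.putReal 4 [j, p', q'] ((weightExp.mul (.cell 0 [.reg 7, .reg 4, .reg 5])).val σ')))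
        (by norm_num : 4 ≤ 5) (by norm_num)
      refine ⟨trivial, hw2.nat_d, hw2.putNat _ (by norm_num) (by norm_num), by simpa using h4, ?_⟩
      intro p q hpq
      by_cases hcur : p = p' ∧ q = q'
      · obtain ⟨rfl, rfl⟩ := hcur
        have hval := hw1.weightExp_val hw1.nat_m
        simp only [RealExp.val, NatExp.val, List.map_cons, List.map_nil, hw.nat_m, h4, h5,
          hw.weightExp_val hw.nat_m, hw.real_re] at hval
        simp [hval, RealExp.val, NatExp.val, hw.weightExp_val hw.nat_m, hw.nat_m,
          h4, h5, hw.real_re, hw.real_im]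
      · have := hout p q (by omega)
        have hne : ¬ ([j, p, q] : List ℕ) = [j, p', q'] := by simpa using hcur
        simpa [Function.update_of_ne hne] using this
    · exact ⟨hw.putNat _ (by norm_num) (by norm_num), by simpa using h4,
        fun p q hpq => hout p (by omega) q (by omega)⟩
    · rintro σ' ⟨hw, h4, hout⟩
      exact ⟨h4, hw.nat_d, hw.putNat _ (by norm_num) (by norm_num),
        fun p hp q hq => hout p q (by omega)⟩
  · simp only [List.map_cons, List.map_nil, NatExp.val, VecExp.val, hj, hm, hσ.vec_y]
    refine ⟨Writing.putNat (x := 4) (σ₀ := σ) ⟨hσ.putVec [j] (y [m]), hj, hm, rfl, ?_, fun _ _ _ _ => rfl, fun _ _ _ _ => rfl,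
      fun l hl => ?_⟩ _ (by norm_num) (by norm_num), fun p hp => absurd hp (Nat.not_lt_zero p)⟩
    · simp
    · simp [hl]

/-- The behaviour of the program: its running time, the number of terms of its output, and the
index that each random number selects. -/
theorem reaches_sampler (hσ : HasInput n d s δ re im y σ) (h0 : σ.real 7 [0] = 0)
    (h2 : σ.nat 2 = 0) (hdr : σ.draws = 0) (hR : 0 ≤ 2000 * (d : ℝ) ^ 2 * (d + s) / δ ^ 2)
    (hk : k = ⌊2000 * (d : ℝ) ^ 2 * (d + s) / δ ^ 2⌋₊) (hT : 0 ≤ tracePrefix d re n) :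
    Reaches ω sampler σ
      (n * (d * 3 + 5) + 2 + (k * 2 + 1 + (k * (n * 4 + 4 + (d * (d * 4 + 4) + 3) + 2) + 2)))
      fun σ' => σ'.nat 2 = k ∧ ∃ S : List ℕ → ℝ, (∀ i ≤ n, S [i] = tracePrefix d re i) ∧
        ∀ j < k, ∃ m, TermWritten n d δ re im y k S j m σ' ∧ (0 < n → Selects n S (ω j) m) := by
  refine Reaches.seq ((reaches_prefixSums hσ h0 h2 hdr).mono le_rfl ?_)
  rintro σ₁ ⟨hσ₁, hS, h2, hdr⟩
  subst hk
  refine Reaches.seq ((reaches_computeSize hσ₁ h2 hdr hR).mono le_rfl ?_)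
  rintro σ₂ ⟨hσ₂, hdr⟩
  generalize ⌊2000 * (d : ℝ) ^ 2 * (d + s) / δ ^ 2⌋₊ = k at *
  set S := σ₁.real 7
  have hS0 : S [0] = 0 := by simpa [tracePrefix] using hS 0 (Nat.zero_le _)
  have hSn : 0 ≤ S [n] := by rwa [hS n le_rfl]
  refine (reaches_forLoop (by decide) (fun i σ' => Ready n d s δ re im y k S σ' ∧
    σ'.draws = i ∧ ∀ j < i, ∃ m, TermWritten n d δ re im y k S j m σ' ∧
      (0 < n → Selects n S (ω j) m)) ?_ hσ₂.nat_k ?_).mono le_rfl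
    fun σ' h => ⟨h.1.nat_k, S, hS, h.2.2⟩
  · rintro i hi σ₃ h6 - ⟨hσ₃, hdr, hout⟩
    refine Reaches.seq ((reaches_drawIndex hσ₃ hS0 hSn).mono le_rfl ?_)
    rintro σ₄ ⟨hσ₄, h6', hdr', h4, h5, h1, hsel⟩
    refine (reaches_writeTerm hσ₄ (h6'.trans h6) rfl).mono le_rfl ?_
    rintro σ₅ ⟨hσ₅, hterm⟩
    refine ⟨hσ₅.nat_j, hσ₅.nat_k, hσ₅.toReady.putNat _ (by norm_num), ?_, fun j hj => ?_⟩
    · exact hσ₅.draws_eq.trans (by rw [hdr', hdr])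
    · rcases (Nat.lt_succ_iff.1 hj).lt_or_eq with hlt | rfl
      · obtain ⟨m, hw, hm⟩ := hout j hlt
        refine ⟨m, ⟨fun p hp q hq => ?_, fun p hp q hq => ?_, ?_⟩, hm⟩
        · exact (hσ₅.re_frame j hlt.ne p q).trans (by rw [h4, hw.re_out p hp q hq])
        · exact (hσ₅.im_frame j hlt.ne p q).trans (by rw [h5, hw.im_out p hp q hq])
        · exact (hσ₅.vec_frame j hlt.ne).trans (by rw [h1, hw.vec_out])
      · exact ⟨σ₄.nat 7, ⟨hterm.re_out, hterm.im_out, hterm.vec_out⟩, hdr ▸ hsel⟩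
  · exact ⟨hσ₂.putNat _ (by norm_num), hdr, fun j hj => absurd hj (Nat.not_lt_zero j)⟩

end Correctness
end RealMachine

/-! ### The output of the program -/

namespace RealMachine

section Output

variable {B : Type*} [NormedAddCommGroup B] {n d k : ℕ} {s δ : ℝ}
variable {X : Fin n → Matrix (Fin d) (Fin d) ℂ} {Y : Fin n → B} {S : List ℕ → ℝ} {σ : State B}

theorem hasInput_inputState (s δ : ℝ) (X : Fin n → Matrix (Fin d) (Fin d) ℂ) (Y : Fin n → B) :
    HasInput n d s δ ((inputState s δ X Y).real 0) ((inputState s δ X Y).real 1)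
      ((inputState s δ X Y).vec 0) (inputState s δ X Y) :=
  ⟨rfl, rfl, rfl, rfl, rfl, rfl, rfl⟩

theorem inputState_re (i : Fin n) (p q : Fin d) :
    (inputState s δ X Y).real 0 [i, p, q] = (X i p q).re := by
  simp [inputState]

theorem inputState_im (i : Fin n) (p q : Fin d) :
    (inputState s δ X Y).real 1 [i, p, q] = (X i p q).im := by
  simp [inputState]

theorem inputState_vec (i : Fin n) : (inputState s δ X Y).vec 0 [i] = Y i := by
  simp [inputState]

theorem sum_diag_inputState (i : Fin n) :
    ∑ p ∈ Finset.range d, (inputState s δ X Y).real 0 [i, p, p] = (X i).trace.re := by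
  rw [Finset.sum_range]
  simp [inputState_re, Matrix.trace]

theorem tracePrefix_inputState :
    tracePrefix d ((inputState s δ X Y).real 0) n = totalTrace X := by
  rw [tracePrefix, Finset.sum_range]
  simp [sum_diag_inputState, totalTrace]

theorem tracePrefix_succ_sub (i : Fin n) :
    tracePrefix d ((inputState s δ X Y).real 0) (i + 1) -
      tracePrefix d ((inputState s δ X Y).real 0) i = (X i).trace.re := by
  simp [tracePrefix, Finset.sum_range_succ, sum_diag_inputState]

theorem weight_eq (hS : ∀ i ≤ n, S [i] = tracePrefix d ((inputState s δ X Y).real 0) i)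
    (i : Fin n) : weight n δ k S i = (samplingProb X i)⁻¹ / (k * (1 + δ / 4)) := by
  rw [weight, hS n le_rfl, hS _ i.2, hS _ i.2.le, tracePrefix_succ_sub, tracePrefix_inputState,
    samplingProb, inv_div]

theorem outMat_eq (hσ : σ.outCard = k)
    (hS : ∀ i ≤ n, S [i] = tracePrefix d ((inputState s δ X Y).real 0) i) {j : Fin σ.outCard}
    {i : Fin n} (hw : TermWritten n d δ ((inputState s δ X Y).real 0)
      ((inputState s δ X Y).real 1) ((inputState s δ X Y).vec 0) k S j i σ) :
    σ.outMat d j = ((samplingProb X i)⁻¹ / (σ.outCard * (1 + δ / 4))) • X i := by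
  ext p q
  rw [hσ, ← weight_eq hS i]
  refine Complex.ext ?_ ?_
  · simp [State.outMat, hw.re_out p p.2 q q.2, inputState_re]
  · simp [State.outMat, hw.im_out p p.2 q q.2, inputState_im]

variable [NormedSpace ℝ B]

/-- The output of the empty sum is good enough when `δ` is large. -/
theorem isSparsification_of_size_lt_one (h : Admissible X Y) (hs : 0 < s) (hδ : 0 < δ)
    (hR : 2000 * (d : ℝ) ^ 2 * (d + s) / δ ^ 2 < 1) (X' : Fin 0 → Matrix (Fin d) (Fin d) ℂ)
    (Y' : Fin 0 → B) : IsSparsification 2000 s δ X Y 0 X' Y' where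
  admissible := ⟨fun i => i.elim0, by simpa using Matrix.PosSemidef.one, fun i => i.elim0⟩
  card_le := by simpa using by positivity
  error_le ρ hρ := by
    have h0 : opMap X' Y' ρ = 0 := by simp [opMap]
    rw [h0, zero_sub, norm_neg]
    rcases Nat.eq_zero_or_pos d with rfl | hd
    · have : opMap X Y ρ = 0 := by simp [opMap, hsInner, Matrix.trace]
      rw [this, norm_zero]
      exact hδ.le
    · refine (h.norm_opMap_le_one hρ).trans ?_
      have hd' : (1 : ℝ) ≤ d := by exact_mod_cast hd
      rw [div_lt_one (by positivity)] at hR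
      have h1 : (1 : ℝ) ≤ (d : ℝ) ^ 2 := one_le_pow₀ hd'
      have h2 : (1 : ℝ) ≤ (d : ℝ) ^ 2 * (d + s) := one_le_mul_of_one_le_of_one_le h1 (by linarith)
      by_contra hlt
      nlinarith

theorem isSparsification_of_totalTrace_eq_zero (h : Admissible X Y) (hδ : 0 < δ)
    (hT : totalTrace X = 0) {X' : Fin k → Matrix (Fin d) (Fin d) ℂ} {Y' : Fin k → B}
    (hX' : ∀ j, X' j = 0) (hY' : ∀ j, ‖Y' j‖ ≤ 1)
    (hk : (k : ℝ) ≤ 2000 * (d : ℝ) ^ 2 * (d + s) / δ ^ 2) :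
    IsSparsification 2000 s δ X Y k X' Y' where
  admissible := ⟨fun j => by rw [hX' j]; exact .zero, by simpa [hX'] using Matrix.PosSemidef.one,
    hY'⟩
  card_le := hk
  error_le ρ hρ := by
    have hX : ∀ i, X i = 0 := fun i => eq_zero_of_trace_re_eq_zero (h.posSemidef i)
      ((Finset.sum_eq_zero_iff_of_nonneg fun i _ => trace_re_nonneg (h.posSemidef i)).1 hT i
        (Finset.mem_univ i))
    simpa [opMap, hsInner, hX, hX'] using hδ.le

/-- Every run yields a sparsification, unless the sampled indices `e` have a large sampling
error, in which case the random numbers lie in the box that `e` determines. -/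
theorem exists_output (h : Admissible X Y) (hs : 0 < s) (hδ : 0 < δ)
    (hk : k = ⌊2000 * (d : ℝ) ^ 2 * (d + s) / δ ^ 2⌋₊) (ω : ℕ → unitInterval) :
    Reaches ω sampler (inputState s δ X Y)
      (n * (d * 3 + 5) + 2 + (k * 2 + 1 + (k * (n * 4 + 4 + (d * (d * 4 + 4) + 3) + 2) + 2)))
      fun σ => IsSparsification 2000 s δ X Y σ.outCard (σ.outMat d) σ.outVec ∨
        0 < k ∧ 0 < totalTrace X ∧ ∃ e : Fin k → Fin n,
          ¬ (samplingErrorSq X Y e ≤ (δ / 2) ^ 2 ∧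
            samplingErrorSq X (fun _ => (1 : ℝ)) e ≤ (δ / 4) ^ 2) ∧
          ∀ j : Fin k, tracePrefix d ((inputState s δ X Y).real 0) (e j) / totalTrace X ≤ ω j ∧
            (ω j : ℝ) ≤ tracePrefix d ((inputState s δ X Y).real 0) (e j + 1) / totalTrace X := by
  have hR : 0 ≤ 2000 * (d : ℝ) ^ 2 * (d + s) / δ ^ 2 := by positivity
  have hkR : (k : ℝ) ≤ 2000 * (d : ℝ) ^ 2 * (d + s) / δ ^ 2 := hk ▸ Nat.floor_le hR
  refine (reaches_sampler (hasInput_inputState s δ X Y) rfl rfl rfl hR hk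
    (by rw [tracePrefix_inputState]; exact h.totalTrace_nonneg)).mono le_rfl ?_
  rintro σ ⟨hσ, S, hS, hout⟩
  rcases h.totalTrace_nonneg.eq_or_lt' with hT | hT
  · left
    have hX : ∀ i, X i = 0 := fun i => eq_zero_of_trace_re_eq_zero (h.posSemidef i)
      ((Finset.sum_eq_zero_iff_of_nonneg fun i _ => trace_re_nonneg (h.posSemidef i)).1 hT i
        (Finset.mem_univ i))
    refine isSparsification_of_totalTrace_eq_zero h hδ hT (fun j => ?_) (fun j => ?_)
      (by rwa [State.outCard, hσ])
    · obtain ⟨m, hw, -⟩ := hout j (hσ ▸ j.2)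
      ext p q
      refine Complex.ext ?_ ?_
      · simp [State.outMat, hw.re_out p p.2 q q.2, inputState, hX]
      · simp [State.outMat, hw.im_out p p.2 q q.2, inputState, hX]
    · obtain ⟨m, hw, -⟩ := hout j (hσ ▸ j.2)
      rw [State.outVec, hw.vec_out]
      by_cases hm : m < n
      · simpa [inputState, hm] using h.norm_le_one ⟨m, hm⟩
      · simp [inputState, hm]
  rcases Nat.eq_zero_or_pos k with hk0 | hk0
  · left
    have hR1 : 2000 * (d : ℝ) ^ 2 * (d + s) / δ ^ 2 < 1 := Nat.floor_eq_zero.1 (hk ▸ hk0)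
    have hσ0 : σ.outCard = 0 := hσ.trans hk0
    have key : ∀ (k' : ℕ) (X' : Fin k' → Matrix (Fin d) (Fin d) ℂ) (Y' : Fin k' → B), k' = 0 →
        IsSparsification 2000 s δ X Y k' X' Y' := by
      rintro _ X' Y' rfl
      exact isSparsification_of_size_lt_one h hs hδ hR1 X' Y'
    exact key _ _ _ hσ0
  have hn : 0 < n := by
    rcases Nat.eq_zero_or_pos n with rfl | hn
    · simp [totalTrace] at hT
    · exact hn
  have hout' : ∀ j : Fin k, ∃ i : Fin n, TermWritten n d δ ((inputState s δ X Y).real 0)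
      ((inputState s δ X Y).real 1) ((inputState s δ X Y).vec 0) k S j i σ ∧
      Selects n S (ω j) i := fun j => by
    obtain ⟨m, hw, hm⟩ := hout j j.2
    exact ⟨⟨m, (hm hn).1⟩, hw, hm hn⟩
  choose e he hsel using hout'
  by_cases hgood : samplingErrorSq X Y e ≤ (δ / 2) ^ 2 ∧
      samplingErrorSq X (fun _ => (1 : ℝ)) e ≤ (δ / 4) ^ 2
  · left
    change σ.outCard = k at hσ
    clear hk
    subst hσ
    obtain ⟨hadm, herr⟩ := h.sparsification_of_samplingErrorSq_le hδ e hgood.1 hgood.2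
      (X' := σ.outMat d) (Y' := σ.outVec) (fun j => outMat_eq rfl hS (he j))
      (fun j => by rw [State.outVec, (he j).vec_out, inputState_vec])
    exact ⟨hadm, hkR, herr⟩
  · right
    refine ⟨hk0, hT, e, hgood, fun j => ?_⟩
    obtain ⟨-, h1, h2⟩ := hsel j
    rw [hS n le_rfl, hS _ (e j).2.le, tracePrefix_inputState] at h1
    rw [hS n le_rfl, hS _ (e j).2, tracePrefix_inputState] at h2
    exact ⟨(div_le_iff₀ hT).2 h1, (le_div_iff₀ hT).2 h2⟩

end Output

/-! ### Probability and running time -/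

open MeasureTheory in
theorem tapeMeasure_box_le {k : ℕ} (a b : Fin k → ℝ) :
    tapeMeasure {ω | ∀ j : Fin k, a j ≤ ω j ∧ (ω j : ℝ) ≤ b j} ≤
      ∏ j, ENNReal.ofReal (b j - a j) := by
  let A : Fin k → Set unitInterval := fun j => {u | a j ≤ u ∧ (u : ℝ) ≤ b j}
  have hA : ∀ j, MeasurableSet (A j) := fun j =>
    (measurableSet_le measurable_const measurable_subtype_coe).inter
      (measurableSet_le measurable_subtype_coe measurable_const)
  have hvol : ∀ j, volume (A j) ≤ ENNReal.ofReal (b j - a j) := fun j => by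
    rw [unitInterval.volume_apply, ← Real.volume_Icc]
    refine measure_mono ?_
    rintro _ ⟨u, hu, rfl⟩
    exact hu
  let A' : ℕ → Set unitInterval := fun j => if h : j < k then A ⟨j, h⟩ else Set.univ
  have hset : {ω : ℕ → unitInterval | ∀ j : Fin k, a j ≤ ω j ∧ (ω j : ℝ) ≤ b j} =
      Set.pi (Finset.range k) A' := by
    ext ω
    simp only [Set.mem_ofPred_eq, Set.mem_pi, Finset.coe_range, Set.mem_Iio]
    refine ⟨fun h j hj => by simpa [A', A, hj] using h ⟨j, hj⟩, fun h j => ?_⟩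
    simpa [A', A] using h j j.2
  rw [hset, tapeMeasure, Measure.infinitePi_pi _ fun j hj => by
    simpa [A', Finset.mem_range.1 hj] using hA _, Finset.prod_range]
  refine Finset.prod_le_prod' fun j _ => ?_
  simpa [A'] using hvol j

theorem sampler_time_le {n d k C : ℕ} {s δ : ℝ} (hC : 100000 ≤ C) (hs : 0 < s) (hδ : 0 < δ)
    (hk : (k : ℝ) ≤ 2000 * (d : ℝ) ^ 2 * (d + s) / δ ^ 2) :
    ((n * (d * 3 + 5) + 2 + (k * 2 + 1 +
      (k * (n * 4 + 4 + (d * (d * 4 + 4) + 3) + 2) + 2)) : ℕ) : ℝ) ≤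
      C * (1 + n + d + s + 1 / δ) ^ C := by
  have hδ' : 0 < 1 / δ := by positivity
  obtain ⟨Q, hQ⟩ : ∃ Q, Q = 1 + n + d + s + 1 / δ := ⟨_, rfl⟩
  rw [← hQ]
  have hn0 : (0 : ℝ) ≤ n := n.cast_nonneg
  have hd0 : (0 : ℝ) ≤ d := d.cast_nonneg
  have hk0 : (0 : ℝ) ≤ k := k.cast_nonneg
  have h1 : 1 ≤ Q := by linarith
  have hn : (n : ℝ) ≤ Q := by linarith
  have hd : (d : ℝ) ≤ Q := by linarith
  have hkQ : (k : ℝ) ≤ 2000 * Q ^ 5 := by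
    calc (k : ℝ) ≤ 2000 * (d : ℝ) ^ 2 * (d + s) * (1 / δ) ^ 2 := by
          refine hk.trans_eq ?_; field_simp
      _ ≤ 2000 * Q ^ 2 * Q * Q ^ 2 := by gcongr <;> linarith
      _ = _ := by ring
  have hQ2 : Q ≤ Q ^ 2 := le_self_pow₀ h1 two_ne_zero
  have h7 : Q ^ 2 ≤ Q ^ 7 := pow_le_pow_right₀ h1 (by norm_num)
  have h57 : Q ^ 5 ≤ Q ^ 7 := pow_le_pow_right₀ h1 (by norm_num)
  have e1 : (n : ℝ) * (d * 3 + 5) ≤ 8 * Q ^ 7 := by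
    calc (n : ℝ) * (d * 3 + 5) ≤ Q * (Q * 3 + 5 * Q) := by gcongr; linarith
      _ = 8 * Q ^ 2 := by ring
      _ ≤ _ := by linarith
  have hdd : (d : ℝ) * (d * 4 + 4) ≤ 8 * Q ^ 2 := by
    calc (d : ℝ) * (d * 4 + 4) ≤ Q * (Q * 4 + 4 * Q) := by gcongr; linarith
      _ = _ := by ring
  have e2 : (k : ℝ) * (n * 4 + 4 + (d * (d * 4 + 4) + 3) + 2) ≤ 42000 * Q ^ 7 := by
    calc (k : ℝ) * (n * 4 + 4 + (d * (d * 4 + 4) + 3) + 2) ≤ 2000 * Q ^ 5 * (21 * Q ^ 2) :=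
          mul_le_mul hkQ (by linarith) (by positivity) (by positivity)
      _ = _ := by ring
  have h1Q : 1 ≤ Q ^ 7 := one_le_pow₀ h1
  have hC' : (100000 : ℝ) ≤ C := by exact_mod_cast hC
  calc _ ≤ 100000 * Q ^ 7 := by push_cast; linarith
    _ ≤ C * Q ^ C := by
      have h7C : Q ^ 7 ≤ Q ^ C := pow_le_pow_right₀ h1 (le_trans (by norm_num) hC)
      exact mul_le_mul hC' h7C (by linarith) C.cast_nonneg

open MeasureTheory in
theorem tapeMeasure_failure_le {B : Type*} [NormedAddCommGroup B] [NormedSpace ℝ B] {n d : ℕ}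
    {s δ : ℝ} {X : Fin n → Matrix (Fin d) (Fin d) ℂ} {Y : Fin n → B} (h : Admissible X Y)
    (hs : 0 < s) (hδ : 0 < δ) (hK : TwoSmooth B (3 * s + 2)) :
    tapeMeasure {ω | ¬ ∃ (σ : State B) (t : ℕ), Exec ω sampler (inputState s δ X Y) σ t ∧
      IsSparsification 2000 s δ X Y σ.outCard (σ.outMat d) σ.outVec} ≤ 1 / 3 := by
  classical
  obtain ⟨k, hk⟩ : ∃ k, k = ⌊2000 * (d : ℝ) ^ 2 * (d + s) / δ ^ 2⌋₊ := ⟨_, rfl⟩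
  set F := {ω | ¬ ∃ (σ : State B) (t : ℕ), Exec ω sampler (inputState s δ X Y) σ t ∧
      IsSparsification 2000 s δ X Y σ.outCard (σ.outMat d) σ.outVec} with hF
  let a : ℕ → ℝ := fun i => tracePrefix d ((inputState s δ X Y).real 0) i / totalTrace X
  let bad : Finset (Fin k → Fin n) := Finset.univ.filter fun e =>
    ¬ (samplingErrorSq X Y e ≤ (δ / 2) ^ 2 ∧
      samplingErrorSq X (fun _ => (1 : ℝ)) e ≤ (δ / 4) ^ 2)
  have hfail : ∀ ω ∈ F, 0 < k ∧ 0 < totalTrace X ∧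
      ω ∈ ⋃ e ∈ bad, {ω | ∀ j : Fin k, a (e j) ≤ ω j ∧ (ω j : ℝ) ≤ a (e j + 1)} := by
    intro ω hω
    obtain ⟨σ, t, hexec, -, hσ⟩ := exists_output h hs hδ hk ω
    obtain ⟨hk0, hT, e, he, hbox⟩ := hσ.resolve_left fun hσ => hω ⟨σ, t, hexec, hσ⟩
    refine ⟨hk0, hT, Set.mem_iUnion₂.2 ⟨e, ?_, hbox⟩⟩
    simpa only [bad, Finset.mem_filter, Finset.mem_univ, true_and] using he
  rcases F.eq_empty_or_nonempty with hempty | ⟨ω₀, hω₀⟩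
  · rw [hempty, measure_empty]
    exact zero_le
  obtain ⟨hk0, hT, -⟩ := hfail ω₀ hω₀
  have hdiff : ∀ i : Fin n, a (i + 1) - a i = samplingProb X i := fun i => by
    simp only [a]
    rw [← sub_div, tracePrefix_succ_sub, samplingProb]
  -- the integer part of a number that is at least `1` is at least half of it
  have hkR : 1000 * (d : ℝ) ^ 2 * (d + s) / δ ^ 2 ≤ k := by
    have hlt : 2000 * (d : ℝ) ^ 2 * (d + s) / δ ^ 2 < k + 1 := hk ▸ Nat.lt_floor_add_one _
    have hk1 : (1 : ℝ) ≤ k := by exact_mod_cast hk0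
    have heq : 2000 * (d : ℝ) ^ 2 * (d + s) / δ ^ 2 =
        2 * (1000 * (d : ℝ) ^ 2 * (d + s) / δ ^ 2) := by ring
    linarith
  calc tapeMeasure F
      ≤ tapeMeasure (⋃ e ∈ bad, {ω | ∀ j : Fin k, a (e j) ≤ ω j ∧ (ω j : ℝ) ≤ a (e j + 1)}) :=
        measure_mono fun ω hω => (hfail ω hω).2.2
    _ ≤ ∑ e ∈ bad, tapeMeasure {ω | ∀ j : Fin k, a (e j) ≤ ω j ∧ (ω j : ℝ) ≤ a (e j + 1)} :=
        measure_biUnion_finset_le _ _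
    _ ≤ ∑ e ∈ bad, ENNReal.ofReal (∏ j, samplingProb X (e j)) := by
        refine Finset.sum_le_sum fun e _ => ?_
        rw [ENNReal.ofReal_prod_of_nonneg fun j _ => h.samplingProb_nonneg _]
        simp only [← hdiff]
        exact tapeMeasure_box_le (fun j => a (e j)) fun j => a (e j + 1)
    _ = ENNReal.ofReal (∑ e ∈ bad, ∏ j, samplingProb X (e j)) :=
        (ENNReal.ofReal_sum_of_nonneg fun e _ =>
          Finset.prod_nonneg fun j _ => h.samplingProb_nonneg _).symm
    _ ≤ ENNReal.ofReal (1 / 3) := ENNReal.ofReal_le_ofReal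
        (h.sum_prob_bad_le hs hK hT hδ hk0 hkR bad fun e he => (Finset.mem_filter.1 he).2)
    _ = 1 / 3 := by
        rw [ENNReal.ofReal_div_of_pos (by norm_num)]
        simp

end RealMachine

end
theorem lemma7 :
    ∃ c : ℝ, 0 < c ∧ ∃ (P : RealMachine.Prog) (C : ℕ),
      ∀ (B : Type*) [NormedAddCommGroup B] [NormedSpace ℝ B] [CompleteSpace B] (s : ℝ),
        0 < s → (∀ τ : ℝ, 0 < τ → smoothnessModulus B τ ≤ s * τ ^ 2) →
      ∀ (d n : ℕ) (X : Fin n → Matrix (Fin d) (Fin d) ℂ) (Y : Fin n → B), Admissible X Y →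
      ∀ δ : ℝ, 0 < δ →
        -- existence of the sparsification
        (∃ (k : ℕ) (X' : Fin k → Matrix (Fin d) (Fin d) ℂ) (Y' : Fin k → B),
          IsSparsification c s δ X Y k X' Y') ∧
        -- the fixed program `P` always halts in polynomial time
        (∀ ω : ℕ → unitInterval, ∃ (σ : RealMachine.State B) (t : ℕ),
          RealMachine.Exec ω P (RealMachine.inputState s δ X Y) σ t ∧
          (t : ℝ) ≤ C * (1 + n + d + s + 1 / δ) ^ C) ∧
        -- and it fails to output a sparsification with probability at most `1 / 3`
        RealMachine.tapeMeasure {ω | ¬ ∃ (σ : RealMachine.State B) (t : ℕ),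
          RealMachine.Exec ω P (RealMachine.inputState s δ X Y) σ t ∧
          IsSparsification c s δ X Y σ.outCard (σ.outMat d) σ.outVec} ≤ 1 / 3 := by
  refine ⟨2000, by norm_num, RealMachine.sampler, 100000, ?_⟩
  intro B _ _ _ s hs hsmooth d n X Y h δ hδ
  have hfail := RealMachine.tapeMeasure_failure_le h hs hδ
    (twoSmooth_of_smoothnessModulus_le hs hsmooth)
  refine ⟨?_, fun ω => ?_, hfail⟩
  · -- a run that does not fail exists, since the whole space has measure `1`
    by_contra hne
    have huniv : {ω | ¬ ∃ (σ : RealMachine.State B) (t : ℕ),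
        RealMachine.Exec ω RealMachine.sampler (RealMachine.inputState s δ X Y) σ t ∧
        IsSparsification 2000 s δ X Y σ.outCard (σ.outMat d) σ.outVec} = Set.univ :=
      Set.eq_univ_of_forall fun ω ⟨σ, t, _, hσ⟩ => hne ⟨_, _, _, hσ⟩
    have : MeasureTheory.IsProbabilityMeasure RealMachine.tapeMeasure := by
      unfold RealMachine.tapeMeasure; infer_instance
    rw [huniv, MeasureTheory.measure_univ] at hfail
    exact absurd hfail (not_le.2 (by
      rw [one_div, ENNReal.inv_lt_one]; norm_num))
  · obtain ⟨σ, t, hexec, ht, -⟩ := RealMachine.exists_output h hs hδ rfl ω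
    exact ⟨σ, t, hexec, (Nat.cast_le.2 ht).trans
      (RealMachine.sampler_time_le le_rfl hs hδ (Nat.floor_le (by positivity)))⟩
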